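/- Let $(\overline M,\overline g)$ be a Lorentzian manifold of dimension $n+2$ with Levi-Civita connection $\overline\nabla$, and let $(M,g,S(TM))$ be a lightlike hypersurface with a given screen distribution: $g=\langle\cdot,\cdot\rangle$ is the induced degenerate metric, $\mathrm{Rad}\,TM$ is its radical, and $TM=S(TM)\oplus \mathrm{Rad}\,TM$ with projection $P:TM\to S(TM)$. Assume that a nowhere zero section $\xi$ of $\mathrm{Rad}\,TM$ is globally given, let $N$ be the section of $T\overline M|_M$ with $\overline g(N,\xi)=1$, $\overline g(N,N)=0$, $\overline g(N,W)=0$ for $W\in S(TM)$, and put $\eta=\overline g(N,\cdot)$. Let $\nabla=Q\circ\overline\nabla$ be the induced connection, $Q$ being the projection on $TM$ along $\mathrm{span}(N)$, and assume that $M$ is totally geodesic, i.e. $\overline\nabla_XY=\nabla_XY$ for all vector fields $X,Y$ on $M$. Let $C(X,PY)=\overline g(\nabla_XPY-P\nabla_XPY,\,N)$ be the second fundamental form of the screen, let $X^\flat=\langle X,\cdot\rangle+\eta(X)\eta$, and let $\nabla^g f$ be the vector field with $(\nabla^g f)^\flat=df$. Let $S$ be an $\mathcal A^\nabla$-tensor,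 i.e. a smooth field of endomorphisms of $TM$ that commutes with $P$ and satisfies $\langle SX,Y\rangle=\langle X,SY\rangle$ and $X^\flat(\nabla S(X,X))=0$ for all $X,Y\in TM$, where $\nabla S(X,Y)=(\nabla_XS)Y$. Let $\lambda_0,\lambda_1,\dots,\lambda_k\in C^\infty(M)$ be its eigenfunctions: $S\xi=\lambda_0\xi$ and, at each point, $\lambda_1,\dots,\lambda_k$ are the pairwise distinct eigenvalues of the restriction of $S$ to $S(TM)$. Put $D_0=\mathrm{Rad}\,TM=\mathrm{span}\{\xi\}$ and $D_i=\mathrm{Ker}(S-\lambda_iI)\cap S(TM)$ for $1\le i\le k$ (so that $D_\alpha=\mathrm{Ker}(S-\lambda_\alpha I)$ for all $0\le\alpha\le k$ wherever $\lambda_0\notin\{\lambda_1,\dots,\lambda_k\}$). Then: (1) for $1\le i\le k$ and all $X\in D_i$, $$\nabla S(X,X)=-\tfrac12\langle X,X\rangle\nabla^g\lambda_i+\Big[\tfrac12\langle X,X\rangle\,\eta(\nabla^g\lambda_i)+(\lambda_i-\lambda_0)\,C(X,X)\Big]\xi ;$$ (2) $D_\alpha\subset\mathrm{Ker}\,d\lambda_\alpha$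 for every $0\le\alpha\le k$; (3) if $1\le i,j\le k$, $i\ne j$, and $X$, $Y$ are (local) smooth sections of $D_i$, $D_j$, then $$\langle\nabla_XX,Y\rangle=\tfrac12\,\frac{Y\cdot\lambda_i}{\lambda_j-\lambda_i}\,\langle X,X\rangle ;$$ (4) if $X$, $Y$ are (local) smooth vector fields on $M$ and $X$ or $Y$ is a section of $D_0$, then $\langle\nabla_XX,Y\rangle=0$. -/

import Mathlib

open Bundle Set
open scoped Manifold ContDiff Topology

noncomputable section

namespace Lightlike

/-! ### Ambient geometry -/

section General

variable {m : ℕ} {L : Type*} [TopologicalSpace L] [ChartedSpace (EuclideanSpace ℝ (Fin m)) L]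
  [IsManifold (𝓡 m) ∞ L]

variable (m L) in
/-- A smooth Lorentzian metric on an `m`-dimensional smooth manifold: a smooth field of symmetric
bilinear forms of index one.  (Having a timelike vector with positive definite orthogonal complement
is the same as being nondegenerate of index one.) -/
structure LorentzMetric where
  /-- The bilinear form on each tangent space. -/
  val (p : L) : TangentSpace (𝓡 m) p →L[ℝ] TangentSpace (𝓡 m) p →L[ℝ] ℝ
  symm (p : L) (v w : TangentSpace (𝓡 m) p) : val p v w = val p w v
  lorentzian (p : L) : ∃ v : TangentSpace (𝓡 m) p, val p v v < 0 ∧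
    ∀ w : TangentSpace (𝓡 m) p, val p v w = 0 → w ≠ 0 → 0 < val p w w
  contMDiff : ContMDiff (𝓡 m)
    ((𝓡 m).prod 𝓘(ℝ, EuclideanSpace ℝ (Fin m) →L[ℝ] EuclideanSpace ℝ (Fin m) →L[ℝ] ℝ)) ∞
    (fun p ↦ TotalSpace.mk' (EuclideanSpace ℝ (Fin m) →L[ℝ] EuclideanSpace ℝ (Fin m) →L[ℝ] ℝ)
      (E := fun p : L ↦ TangentSpace (𝓡 m) p →L[ℝ] TangentSpace (𝓡 m) p →L[ℝ] ℝ) p (val p))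

/-- `cov` is the Levi-Civita connection of `G`: torsion-free and metric. -/
structure IsLeviCivita (G : LorentzMetric m L)
    (cov : CovariantDerivative (𝓡 m) (EuclideanSpace ℝ (Fin m))
      (TangentSpace (𝓡 m) : L → Type _)) : Prop where
  torsion_free {X Y : ∀ p : L, TangentSpace (𝓡 m) p} {p : L}
    (hX : MDifferentiableAt (𝓡 m) (𝓡 m).tangent (fun q ↦ (⟨q, X q⟩ : TangentBundle (𝓡 m) L)) p)
    (hY : MDifferentiableAt (𝓡 m) (𝓡 m).tangent (fun q ↦ (⟨q, Y q⟩ : TangentBundle (𝓡 m) L)) p) :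
    cov Y p (X p) - cov X p (Y p) = VectorField.mlieBracket (𝓡 m) X Y p
  metric {X Y : ∀ p : L, TangentSpace (𝓡 m) p} {p : L}
    (hX : MDifferentiableAt (𝓡 m) (𝓡 m).tangent (fun q ↦ (⟨q, X q⟩ : TangentBundle (𝓡 m) L)) p)
    (hY : MDifferentiableAt (𝓡 m) (𝓡 m).tangent (fun q ↦ (⟨q, Y q⟩ : TangentBundle (𝓡 m) L)) p)
    (v : TangentSpace (𝓡 m) p) :
    mvfderiv (𝓡 m) (fun q ↦ G.val q (X q) (Y q)) p v =
      G.val p (cov X p v) (Y p) + G.val p (X p) (cov Y p v)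

/-- A rank `r` smooth distribution: near every point it is spanned by `r` linearly independent
smooth vector fields. -/
def IsSmoothDistribution (r : ℕ) (D : ∀ p : L, Submodule ℝ (TangentSpace (𝓡 m) p)) : Prop :=
  ∀ p : L, ∃ U : Set L, IsOpen U ∧ p ∈ U ∧
    ∃ W : Fin r → ∀ q : L, TangentSpace (𝓡 m) q,
      (∀ a, ContMDiffOn (𝓡 m) (𝓡 m).tangent ∞
        (fun q ↦ (⟨q, W a q⟩ : TangentBundle (𝓡 m) L)) U) ∧
      ∀ q ∈ U, LinearIndependent ℝ (fun a ↦ W a q) ∧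
        Submodule.span ℝ (range fun a ↦ W a q) = D q

end General

section Along

variable {d m : ℕ} {M : Type*} [TopologicalSpace M] [ChartedSpace (EuclideanSpace ℝ (Fin d)) M]
  {L : Type*} [TopologicalSpace L] [ChartedSpace (EuclideanSpace ℝ (Fin m)) L]
  [IsManifold (𝓡 m) ∞ L]

/-- The covariant derivative `∇̄_v V` at `x` of a field `V` along a map `ι : M → L`, in the direction
`v ∈ T_x M` (the pull-back connection).  In the frame `(e_a)` of `TL` given by the preferred
trivialization at `ι x`, writing `V = ∑ V^a (e_a ∘ ι)`, it is
`∑ dV^a(v) e_a + ∑ V^a(x) ∇̄_{dι v} e_a`; the field `∑ V^a(x) e_a` is `FiberBundle.extend`. -/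
def covAlong (cov : CovariantDerivative (𝓡 m) (EuclideanSpace ℝ (Fin m))
      (TangentSpace (𝓡 m) : L → Type _)) (ι : M → L)
    (V : ∀ x : M, TangentSpace (𝓡 m) (ι x)) (x : M) (v : TangentSpace (𝓡 d) x) :
    TangentSpace (𝓡 m) (ι x) :=
  let e := trivializationAt (EuclideanSpace ℝ (Fin m)) (TangentSpace (𝓡 m) : L → Type _) (ι x)
  e.symm (ι x) (mvfderiv (𝓡 d) (fun y ↦ (e ⟨ι y, V y⟩).2) x v) +
    cov (FiberBundle.extend (EuclideanSpace ℝ (Fin m)) (V x)) (ι x) (mfderiv (𝓡 d) (𝓡 m) ι x v)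

/-- The induced (possibly degenerate) metric `ι^* G`. -/
def inducedForm (G : LorentzMetric m L) (ι : M → L) (x : M) :
    TangentSpace (𝓡 d) x →ₗ[ℝ] TangentSpace (𝓡 d) x →ₗ[ℝ] ℝ :=
  LinearMap.mk₂ ℝ
    (fun v w ↦ G.val (ι x) (mfderiv (𝓡 d) (𝓡 m) ι x v) (mfderiv (𝓡 d) (𝓡 m) ι x w))
    (by intros; simp) (by intros; simp) (by intros; simp) (by intros; simp)

/-- The radical `T_x M ∩ (T_x M)^⊥` of the induced metric. -/
def radical (G : LorentzMetric m L) (ι : M → L) (x : M) : Submodule ℝ (TangentSpace (𝓡 d) x) :=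
  LinearMap.ker (inducedForm (d := d) G ι x)

end Along

/-! ### Lightlike hypersurfaces with a screen distribution -/

variable {n : ℕ} {L : Type*} [TopologicalSpace L]
  [ChartedSpace (EuclideanSpace ℝ (Fin (n + 2))) L] [IsManifold (𝓡 (n + 2)) ∞ L]
  {M : Type*} [TopologicalSpace M] [ChartedSpace (EuclideanSpace ℝ (Fin (n + 1))) M]
  [IsManifold (𝓡 (n + 1)) ∞ M]

variable (M) in
/-- An (immersed) lightlike hypersurface `(M, g, S(TM))` of the Lorentzian manifold `(L, G)` with a
given screen distribution, a globally defined null section `ξ` of the radical distribution, and the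
associated null transversal section `N` of `TL` along `M`. -/
structure LightlikeHypersurface (G : LorentzMetric (n + 2) L) where
  /-- the immersion of the hypersurface -/
  ι : M → L
  contMDiff_ι : ContMDiff (𝓡 (n + 1)) (𝓡 (n + 2)) ∞ ι
  injective_dι (x : M) : Function.Injective (mfderiv (𝓡 (n + 1)) (𝓡 (n + 2)) ι x)
  /-- the global null vector field -/
  ξ (x : M) : TangentSpace (𝓡 (n + 1)) x
  contMDiff_ξ : ContMDiff (𝓡 (n + 1)) (𝓡 (n + 1)).tangent ∞
    (fun x ↦ (⟨x, ξ x⟩ : TangentBundle (𝓡 (n + 1)) M))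
  ξ_ne_zero (x : M) : ξ x ≠ 0
  ξ_mem_radical (x : M) : ξ x ∈ radical G ι x
  /-- the screen distribution `S(TM)` -/
  screen (x : M) : Submodule ℝ (TangentSpace (𝓡 (n + 1)) x)
  isSmoothDistribution_screen : IsSmoothDistribution n screen
  isCompl_screen (x : M) : IsCompl (screen x) (radical G ι x)
  /-- the null transversal section normalized by `ξ` -/
  N (x : M) : TangentSpace (𝓡 (n + 2)) (ι x)
  contMDiff_N : ContMDiff (𝓡 (n + 1)) (𝓡 (n + 2)).tangent ∞
    (fun x ↦ (⟨ι x, N x⟩ : TangentBundle (𝓡 (n + 2)) L))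
  N_ξ (x : M) : G.val (ι x) (N x) (mfderiv (𝓡 (n + 1)) (𝓡 (n + 2)) ι x (ξ x)) = 1
  N_N (x : M) : G.val (ι x) (N x) (N x) = 0
  N_screen (x : M) (w : TangentSpace (𝓡 (n + 1)) x) (hw : w ∈ screen x) :
    G.val (ι x) (N x) (mfderiv (𝓡 (n + 1)) (𝓡 (n + 2)) ι x w) = 0

namespace LightlikeHypersurface

variable {G : LorentzMetric (n + 2) L} (H : LightlikeHypersurface M G)

/-- The differential `dι_x : T_x M → T_{ι x} L`. -/
def dι (x : M) : TangentSpace (𝓡 (n + 1)) x →ₗ[ℝ] TangentSpace (𝓡 (n + 2)) (H.ι x) :=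
  (mfderiv (𝓡 (n + 1)) (𝓡 (n + 2)) H.ι x).toLinearMap

/-- The induced degenerate metric `g = ⟨·,·⟩` on `M`. -/
def g (x : M) : TangentSpace (𝓡 (n + 1)) x →ₗ[ℝ] TangentSpace (𝓡 (n + 1)) x →ₗ[ℝ] ℝ :=
  inducedForm G H.ι x

/-- The radical distribution `Rad TM`. -/
def rad (x : M) : Submodule ℝ (TangentSpace (𝓡 (n + 1)) x) := radical G H.ι x

/-- The one-form `η = G(N, ·)` on `M`. -/
def η (x : M) : TangentSpace (𝓡 (n + 1)) x →ₗ[ℝ] ℝ :=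
  (G.val (H.ι x) (H.N x)).toLinearMap ∘ₗ H.dι x

/-- The projection `P : TM → S(TM)` along `Rad TM`. -/
def P (x : M) : TangentSpace (𝓡 (n + 1)) x →ₗ[ℝ] TangentSpace (𝓡 (n + 1)) x :=
  (H.screen x).projection (H.rad x) (H.isCompl_screen x)

lemma g_apply (x : M) (v w : TangentSpace (𝓡 (n + 1)) x) :
    H.g x v w = G.val (H.ι x) (H.dι x v) (H.dι x w) := rfl

lemma mem_rad_iff {x : M} {v : TangentSpace (𝓡 (n + 1)) x} :
    v ∈ H.rad x ↔ ∀ w, H.g x v w = 0 := by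
  unfold rad radical g
  rw [LinearMap.mem_ker, LinearMap.ext_iff]
  rfl

lemma g_ξ (x : M) (v : TangentSpace (𝓡 (n + 1)) x) : H.g x v (H.ξ x) = 0 := by
  rw [g_apply, G.symm]
  exact H.mem_rad_iff.1 (H.ξ_mem_radical x) v

lemma η_ξ (x : M) : H.η x (H.ξ x) = 1 := H.N_ξ x

lemma finrank_tangent (k : ℕ) {K : Type*} [TopologicalSpace K]
    [ChartedSpace (EuclideanSpace ℝ (Fin k)) K] (p : K) :
    Module.finrank ℝ (TangentSpace (𝓡 k) p) = k :=
  finrank_euclideanSpace_fin (𝕜 := ℝ) (n := k)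

lemma finite_tangent (k : ℕ) {K : Type*} [TopologicalSpace K]
    [ChartedSpace (EuclideanSpace ℝ (Fin k)) K] (p : K) :
    FiniteDimensional ℝ (TangentSpace (𝓡 k) p) :=
  inferInstanceAs (FiniteDimensional ℝ (EuclideanSpace ℝ (Fin k)))

/-- The decomposition `TL|_M = TM ⊕ tr(TM)`, where `tr(TM)` is spanned by `N`. -/
lemma isCompl_transversal (x : M) :
    IsCompl (LinearMap.range (H.dι x)) (Submodule.span ℝ {H.N x}) := by
  have := finite_tangent (n + 2) (H.ι x)
  have := finite_tangent (n + 1) x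
  have hN : G.val (H.ι x) (H.N x) (H.dι x (H.ξ x)) = 1 := H.N_ξ x
  have hN0 : H.N x ≠ 0 := by
    intro h
    rw [h] at hN
    simp at hN
  rw [Submodule.isCompl_iff_disjoint]
  · rw [Submodule.disjoint_def]
    rintro _ ⟨v, rfl⟩ hv
    obtain ⟨a, ha⟩ := Submodule.mem_span_singleton.1 hv
    have h1 := H.g_ξ x v
    rw [g_apply, ← ha, map_smul, smul_apply, hN] at h1
    have ha0 : a = 0 := by simpa using h1
    rw [← ha, ha0, zero_smul]
  · have hr : Module.finrank ℝ (LinearMap.range (H.dι x)) = n + 1 :=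
      (LinearMap.finrank_range_of_inj (f := H.dι x) (H.injective_dι x)).trans
        (finrank_tangent (n + 1) x)
    rw [hr, finrank_span_singleton hN0, finrank_tangent]

/-- The projection `Q : TL|_M → TM` along `tr(TM)`. -/
def Q (x : M) : TangentSpace (𝓡 (n + 2)) (H.ι x) →ₗ[ℝ] TangentSpace (𝓡 (n + 1)) x :=
  LinearMap.linearProjOfIsCompl (Submodule.span ℝ {H.N x}) (H.dι x) (H.injective_dι x)
    (H.isCompl_transversal x)

/-! ### Induced connection and fundamental forms -/

section Connection

variable (cov : CovariantDerivative (𝓡 (n + 2)) (EuclideanSpace ℝ (Fin (n + 2)))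
  (TangentSpace (𝓡 (n + 2)) : L → Type _))

/-- The ambient derivative `∇̄_v Y` of a vector field `Y` on `M`; the arguments are
`Y`, the point and `v`. -/
def ambientNabla (Y : ∀ x : M, TangentSpace (𝓡 (n + 1)) x) (x : M)
    (v : TangentSpace (𝓡 (n + 1)) x) : TangentSpace (𝓡 (n + 2)) (H.ι x) :=
  covAlong cov H.ι (fun y ↦ H.dι y (Y y)) x v

/-- The induced connection `∇_v Y = Q (∇̄_v Y)`. -/
def nabla (Y : ∀ x : M, TangentSpace (𝓡 (n + 1)) x) (x : M)
    (v : TangentSpace (𝓡 (n + 1)) x) : TangentSpace (𝓡 (n + 1)) x :=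
  H.Q x (H.ambientNabla cov Y x v)

/-- The hypersurface is totally geodesic: its second fundamental form
`h(v, Y) = ∇̄_v Y - ∇_v Y` vanishes. -/
def IsTotallyGeodesic : Prop :=
  ∀ (x : M) (Y : ∀ x : M, TangentSpace (𝓡 (n + 1)) x),
    ContMDiffAt (𝓡 (n + 1)) (𝓡 (n + 1)).tangent ∞
      (fun y ↦ (⟨y, Y y⟩ : TangentBundle (𝓡 (n + 1)) M)) x →
    ∀ v : TangentSpace (𝓡 (n + 1)) x,
      H.ambientNabla cov Y x v - H.dι x (H.nabla cov Y x v) = 0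

/-- The local second fundamental form of the screen, `(v, w) ↦ C(v, P w) = G(h^*(v, P w), N)`, where
`h^*(X, PY) = ∇_X PY - P (∇_X PY)`.  As this is tensorial it is computed with an arbitrary local
extension of `w`. -/
def C (x : M) (v w : TangentSpace (𝓡 (n + 1)) x) : ℝ :=
  let Z := H.nabla cov
    (fun y ↦ H.P y (FiberBundle.extend (EuclideanSpace ℝ (Fin (n + 1))) w y)) x v
  H.η x (Z - H.P x Z)

/-- The covariant derivative `∇S(v, w) = (∇_v S) w = ∇_v (S W) - S (∇_v W)` of an endomorphism field,
computed with an arbitrary local extension `W` of `w`. -/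
def nablaEnd (S : ∀ x : M, TangentSpace (𝓡 (n + 1)) x →L[ℝ] TangentSpace (𝓡 (n + 1)) x)
    (x : M) (v w : TangentSpace (𝓡 (n + 1)) x) : TangentSpace (𝓡 (n + 1)) x :=
  H.nabla cov
      (fun y ↦ S y (FiberBundle.extend (EuclideanSpace ℝ (Fin (n + 1))) w y)) x v -
    S x (H.nabla cov (FiberBundle.extend (EuclideanSpace ℝ (Fin (n + 1))) w) x v)

end Connection

/-! ### Musical isomorphism and gradient -/

/-- `X^♭ = g(X, ·) + η(X) η`. -/
def flat (x : M) : TangentSpace (𝓡 (n + 1)) x →ₗ[ℝ] Module.Dual ℝ (TangentSpace (𝓡 (n + 1)) x) :=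
  H.g x + (H.η x).smulRight (H.η x)

lemma flat_apply (x : M) (v w : TangentSpace (𝓡 (n + 1)) x) :
    H.flat x v w = H.g x v w + H.η x v * H.η x w := rfl

lemma η_screen (x : M) {v : TangentSpace (𝓡 (n + 1)) x} (hv : v ∈ H.screen x) : H.η x v = 0 :=
  H.N_screen x v hv

lemma finrank_screen (x : M) : Module.finrank ℝ (H.screen x) = n := by
  obtain ⟨U, -, hx, W, -, hW⟩ := H.isSmoothDistribution_screen x
  obtain ⟨h1, h2⟩ := hW x hx
  rw [← h2, finrank_span_eq_card h1, Fintype.card_fin]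

/-- The radical distribution is spanned by `ξ`. -/
lemma rad_eq_span (x : M) : H.rad x = Submodule.span ℝ {H.ξ x} := by
  have := finite_tangent (n + 1) x
  have h := Submodule.finrank_add_eq_of_isCompl (H.isCompl_screen x)
  rw [finrank_screen, finrank_tangent] at h
  symm
  apply Submodule.eq_of_le_of_finrank_eq
  · rw [Submodule.span_singleton_le_iff_mem]
    exact H.ξ_mem_radical x
  · rw [finrank_span_singleton (H.ξ_ne_zero x)]
    have h' : n + Module.finrank ℝ (H.rad x) = n + 1 := h
    omega

lemma flat_injective (x : M) : Function.Injective (H.flat x) := by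
  rw [injective_iff_map_eq_zero]
  intro v hv
  have h0 (w : TangentSpace (𝓡 (n + 1)) x) : H.g x v w + H.η x v * H.η x w = 0 := by
    rw [← flat_apply, hv]
    rfl
  have h1 : H.η x v = 0 := by
    have := h0 (H.ξ x)
    rwa [g_ξ, η_ξ, zero_add, mul_one] at this
  have h2 : v ∈ H.rad x := by
    rw [mem_rad_iff]
    intro w
    simpa [h1] using h0 w
  rw [rad_eq_span, Submodule.mem_span_singleton] at h2
  obtain ⟨a, rfl⟩ := h2
  rw [map_smul, η_ξ] at h1
  have ha : a = 0 := by simpa using h1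
  rw [ha, zero_smul]

/-- The duality isomorphism `♭ : T_x M ≃ T_x^* M`. -/
def flatEquiv (x : M) :
    TangentSpace (𝓡 (n + 1)) x ≃ₗ[ℝ] Module.Dual ℝ (TangentSpace (𝓡 (n + 1)) x) :=
  have := finite_tangent (n + 1) x
  LinearEquiv.ofInjectiveOfFinrankEq (H.flat x) (H.flat_injective x)
    (Subspace.dual_finrank_eq).symm

/-- The gradient `∇^g f`, defined by `g̃(∇^g f, X) = df(X)` with `g̃(X, Y) = X^♭(Y)`. -/
def grad (f : M → ℝ) (x : M) : TangentSpace (𝓡 (n + 1)) x :=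
  (H.flatEquiv x).symm (mvfderiv (𝓡 (n + 1)) f x).toLinearMap

lemma flat_grad (f : M → ℝ) (x : M) (v : TangentSpace (𝓡 (n + 1)) x) :
    H.flat x (H.grad f x) v = mvfderiv (𝓡 (n + 1)) f x v := by
  have h := (H.flatEquiv x).apply_symm_apply (mvfderiv (𝓡 (n + 1)) f x).toLinearMap
  exact LinearMap.congr_fun h v

/-! ### `A^∇`-tensors and their eigendistributions -/

/-- `S` is an `A^∇`-tensor on `(M, g, S(TM))`. -/
structure IsATensor (cov : CovariantDerivative (𝓡 (n + 2)) (EuclideanSpace ℝ (Fin (n + 2)))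
      (TangentSpace (𝓡 (n + 2)) : L → Type _))
    (S : ∀ x : M, TangentSpace (𝓡 (n + 1)) x →L[ℝ] TangentSpace (𝓡 (n + 1)) x) : Prop where
  contMDiff : ContMDiff (𝓡 (n + 1))
    ((𝓡 (n + 1)).prod 𝓘(ℝ, EuclideanSpace ℝ (Fin (n + 1)) →L[ℝ] EuclideanSpace ℝ (Fin (n + 1)))) ∞
    (fun x ↦ TotalSpace.mk' (EuclideanSpace ℝ (Fin (n + 1)) →L[ℝ] EuclideanSpace ℝ (Fin (n + 1)))
      (E := fun x : M ↦ TangentSpace (𝓡 (n + 1)) x →L[ℝ] TangentSpace (𝓡 (n + 1)) x) x (S x))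
  screen_preserving (x : M) (v : TangentSpace (𝓡 (n + 1)) x) : H.P x (S x v) = S x (H.P x v)
  symm (x : M) (v w : TangentSpace (𝓡 (n + 1)) x) : H.g x (S x v) w = H.g x v (S x w)
  flat_nablaEnd (x : M) (v : TangentSpace (𝓡 (n + 1)) x) :
    H.flat x v (H.nablaEnd cov S x v v) = 0

section Eigen

variable (S : ∀ x : M, TangentSpace (𝓡 (n + 1)) x →L[ℝ] TangentSpace (𝓡 (n + 1)) x)
  {k : ℕ} (ev : Fin (k + 1) → M → ℝ)

/-- `ev 0, ev 1, …, ev k` are the (smooth) eigenfunctions of `S`: `S ξ = λ₀ ξ`, and at every point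
`λ₁, …, λ_k` are, without repetition, all the eigenvalues of `S` on the screen distribution. -/
structure IsEigenfunctions : Prop where
  contMDiff (a : Fin (k + 1)) : ContMDiff (𝓡 (n + 1)) 𝓘(ℝ) ∞ (ev a)
  apply_ξ (x : M) : S x (H.ξ x) = ev 0 x • H.ξ x
  injective (x : M) : Function.Injective (fun i : Fin k ↦ ev i.succ x)
  range_eq (x : M) : range (fun i : Fin k ↦ ev i.succ x) =
    {μ : ℝ | ∃ v ∈ H.screen x, v ≠ 0 ∧ S x v = μ • v}

/-- The distributions `D₀ = Rad TM` and `D_i = {v ∈ S(TM) | S v = λ_i v}`, `1 ≤ i ≤ k`.  Where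
`λ_i ≠ λ₀` for all `i ≥ 1` these are the eigenspaces `Ker (S - λ_α I)`, see
`eigenDistribution_eq_ker`. -/
def eigenDistribution (a : Fin (k + 1)) (x : M) : Submodule ℝ (TangentSpace (𝓡 (n + 1)) x) :=
  Fin.cases (H.rad x)
    (fun i ↦ H.screen x ⊓ LinearMap.ker ((S x).toLinearMap - ev i.succ x • LinearMap.id)) a

variable {S ev}

lemma eigenDistribution_eq_ker
    (hP : ∀ (x : M) (v : TangentSpace (𝓡 (n + 1)) x), H.P x (S x v) = S x (H.P x v))
    (hev : H.IsEigenfunctions S ev) (x : M) (hne : ∀ i : Fin k, ev i.succ x ≠ ev 0 x)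
    (a : Fin (k + 1)) :
    H.eigenDistribution S ev a x =
      LinearMap.ker ((S x).toLinearMap - ev a x • LinearMap.id) := by
  have hmem (c : ℝ) (v : TangentSpace (𝓡 (n + 1)) x) :
      v ∈ LinearMap.ker ((S x).toLinearMap - c • LinearMap.id) ↔ S x v = c • v := by
    simp [LinearMap.mem_ker, sub_eq_zero]
  have hscr (v : TangentSpace (𝓡 (n + 1)) x) : H.P x v ∈ H.screen x :=
    Submodule.projection_apply_mem _ v
  have hdec (v : TangentSpace (𝓡 (n + 1)) x) : ∃ c : ℝ, v = H.P x v + c • H.ξ x := by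
    have h1 : v - H.P x v ∈ H.rad x := by
      have h2 : H.P x (v - H.P x v) = 0 := by
        have h3 : H.P x (H.P x v) = H.P x v :=
          Submodule.projection_apply_of_mem_left (H.isCompl_screen x) (hscr v)
        rw [map_sub, h3, sub_self]
      exact (Submodule.projection_apply_eq_zero_iff _).1 h2
    rw [rad_eq_span, Submodule.mem_span_singleton] at h1
    obtain ⟨c, hc⟩ := h1
    exact ⟨c, by rw [hc]; abel⟩
  ext v
  rw [hmem]
  cases a using Fin.cases with
  | zero =>
    change v ∈ H.rad x ↔ _
    constructor
    · intro h
      rw [rad_eq_span, Submodule.mem_span_singleton] at h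
      obtain ⟨c, rfl⟩ := h
      rw [map_smul, hev.apply_ξ, smul_comm]
    · intro h
      by_cases h0 : H.P x v = 0
      · exact (Submodule.projection_apply_eq_zero_iff _).1 h0
      · have h1 : ev 0 x ∈ range (fun i : Fin k ↦ ev i.succ x) := by
          rw [hev.range_eq]
          exact ⟨H.P x v, hscr v, h0, by rw [← hP, h, map_smul]⟩
        obtain ⟨i, hi⟩ := h1
        exact absurd hi (hne i)
  | succ i =>
    change v ∈ H.screen x ⊓ _ ↔ _
    rw [Submodule.mem_inf, hmem]
    refine ⟨fun h ↦ h.2, fun h ↦ ⟨?_, h⟩⟩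
    obtain ⟨c, hc⟩ := hdec v
    have h2 : S x (H.P x v) = ev i.succ x • H.P x v := by rw [← hP, h, map_smul]
    have h3 : c • ev 0 x • H.ξ x = ev i.succ x • c • H.ξ x := by
      have h4 := h
      rw [hc, map_add, map_smul, hev.apply_ξ, smul_add, h2] at h4
      exact add_left_cancel h4
    have h5 : (c * (ev 0 x - ev i.succ x)) • H.ξ x = 0 := by
      rw [mul_sub, sub_smul, mul_smul, h3, smul_smul, mul_comm c (ev i.succ x), sub_self]
    have h6 : c = 0 := by
      rcases smul_eq_zero.1 h5 with h7 | h7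
      · rcases mul_eq_zero.1 h7 with h8 | h8
        · exact h8
        · exact absurd (sub_eq_zero.1 h8).symm (hne i)
      · exact absurd h7 (H.ξ_ne_zero x)
    rw [hc, h6, zero_smul, add_zero]
    exact hscr v

end Eigen

end LightlikeHypersurface

end Lightlike

end

/-! Total geodesy identifies `∇` with the restriction of the metric connection `∇̄`, so `∇` is
compatible with the degenerate metric (`mvfderiv_g`). Differentiating the symmetry of `S` then shows
that each `∇S(v, ·)` is `g`-symmetric (`g_nablaEnd_symm`). The condition `v^♭(∇S(v, v)) = 0` is the
vanishing of a cubic form; its polarization at a screen vector `X`, where `η(X) = 0`, reads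
`2⟨∇S(X,X), Y⟩ + η(Y) η(∇S(X,X)) + ⟨∇S(Y,X), X⟩ = 0`.

If `X ∈ D_i` is extended to a local section of `D_i`, then `∇S(Y,X) = (Y·λ_i) X - (S - λ_i)∇_Y X`,
and pairing with `X` kills the second term. The last summand is therefore `(Y·λ_i)⟨X,X⟩`
(`polarization_eigen`). Taking `Y = X` gives (2) for `i ≥ 1`, since `g` is positive definite on the
screen; an arbitrary `Y` gives (1) after applying `♭`; `Y ∈ D_j` gives (3). For `D_0` one tests the
tensor condition on `ξ`, and (4) holds because `Rad TM` is parallel.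

Sections of `D_i` through a given vector come from the polynomial `∏_{j≠i} (S - λ_j)` applied to a
screen field: on the screen `S` is symmetric for a positive definite form, hence is annihilated by
`∏_j (S - λ_j)`. -/

namespace Lightlike

/-! ### Calculus of vector-valued functions on a manifold. -/

section Calculus

variable {E : Type*} [NormedAddCommGroup E] [NormedSpace ℝ E] {H : Type*} [TopologicalSpace H]
  {I : ModelWithCorners ℝ E H} {M : Type*} [TopologicalSpace M] [ChartedSpace H M]
  {F F' : Type*} [NormedAddCommGroup F] [NormedSpace ℝ F] [NormedAddCommGroup F'] [NormedSpace ℝ F']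

lemma mvfderiv_congr_of_eventuallyEq {f g : M → F} {x : M} (h : f =ᶠ[𝓝 x] g) :
    mvfderiv I f x = mvfderiv I g x := by
  ext v
  exact congrArg (fun T : E →L[ℝ] F ↦ T v) (h.mfderiv_eq (I := I) (I' := 𝓘(ℝ, F)))

lemma mvfderiv_clm_apply {A : M → F →L[ℝ] F'} {c : M → F} {x : M}
    (hA : MDifferentiableAt I 𝓘(ℝ, F →L[ℝ] F') A x) (hc : MDifferentiableAt I 𝓘(ℝ, F) c x)
    (v : TangentSpace I x) :
    mvfderiv I (fun y ↦ A y (c y)) x v = mvfderiv I A x v (c x) + A x (mvfderiv I c x v) := by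
  -- Both derivatives are retyped on the model space, where the product rule for Fréchet derivatives
  -- applies.
  let A' : E →L[ℝ] F →L[ℝ] F' := mvfderiv I A x
  let c' : E →L[ℝ] F := mvfderiv I c x
  let T : E →L[ℝ] F' := (A x).comp c' + A'.flip (c x)
  have h : HasMFDerivAt I 𝓘(ℝ, F') (fun y ↦ A y (c y)) x T := by
    refine ⟨hA.continuousAt.clm_apply hc.continuousAt, ?_⟩
    have := hA.hasMFDerivAt.2.clm_apply hc.hasMFDerivAt.2
    simp only [writtenInExtChartAt, extChartAt_model_space_eq_id, PartialEquiv.refl_coe,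
      Function.comp_def, id_eq, extChartAt_to_inv] at this ⊢
    exact this
  have h2 := congrArg (fun T : E →L[ℝ] F' ↦ T v) h.mfderiv
  refine Eq.trans h2 ?_
  exact add_comm _ _

end Calculus

/-! ### Linearity of the canonical local extension of a vector. -/

section Extend

variable {B F : Type*} [TopologicalSpace B] [NormedAddCommGroup F] [NormedSpace ℝ F]
  {E : B → Type*} [TopologicalSpace (TotalSpace F E)] [∀ x, AddCommGroup (E x)]
  [∀ x, Module ℝ (E x)] [∀ x, TopologicalSpace (E x)] [FiberBundle F E] [VectorBundle ℝ F E]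

/-- Near the base point the extension is a composite of two linear maps, which makes it linear in
`v` there. -/
lemma extend_eventuallyEq_symmₗ {x : B} (v : E x) :
    ∀ᶠ y in 𝓝 x, FiberBundle.extend F v y =
      (trivializationAt F E x).symmₗ ℝ y ((trivializationAt F E x).linearMapAt ℝ x v) := by
  have hx := FiberBundle.mem_baseSet_trivializationAt' (F := F) (E := E) x
  filter_upwards [(trivializationAt F E x).open_baseSet.mem_nhds hx] with y hy
  rw [Trivialization.linearMapAt_def_of_mem _ hx, Trivialization.symmₗ_apply _ hy]
  rfl

lemma extend_add_eventuallyEq {x : B} (v w : E x) : ∀ᶠ y in 𝓝 x,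
    FiberBundle.extend F (v + w) y = (FiberBundle.extend F v + FiberBundle.extend F w) y := by
  filter_upwards [extend_eventuallyEq_symmₗ (F := F) v, extend_eventuallyEq_symmₗ (F := F) w,
    extend_eventuallyEq_symmₗ (F := F) (v + w)] with y h1 h2 h3
  rw [h3, Pi.add_apply, h1, h2, map_add, map_add]

lemma extend_smul_eventuallyEq {x : B} (a : ℝ) (v : E x) : ∀ᶠ y in 𝓝 x,
    FiberBundle.extend F (a • v) y = (a • FiberBundle.extend F v) y := by
  filter_upwards [extend_eventuallyEq_symmₗ (F := F) v,
    extend_eventuallyEq_symmₗ (F := F) (a • v)] with y h1 h2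
  rw [h2, Pi.smul_apply, h1, map_smul, map_smul]

end Extend

/-! ### The connection pulled back along a map: Leibniz rule and metric compatibility. -/

section Along

variable {d m : ℕ} {M : Type*} [TopologicalSpace M] [ChartedSpace (EuclideanSpace ℝ (Fin d)) M]
  {L : Type*} [TopologicalSpace L] [ChartedSpace (EuclideanSpace ℝ (Fin m)) L]
  [IsManifold (𝓡 m) ∞ L]
  (cov : CovariantDerivative (𝓡 m) (EuclideanSpace ℝ (Fin m))
    (TangentSpace (𝓡 m) : L → Type _))
  {ι : M → L} {V W : ∀ x : M, TangentSpace (𝓡 m) (ι x)} {x : M}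

/-- Differentiability at `x` of a vector field along `ι`. -/
def DiffAlongAt (ι : M → L) (V : ∀ x : M, TangentSpace (𝓡 m) (ι x)) (x : M) : Prop :=
  MDifferentiableAt (𝓡 d) (𝓡 m).tangent (fun y ↦ (⟨ι y, V y⟩ : TangentBundle (𝓡 m) L)) x

/-- The components at `y` of a field along `ι` in the preferred trivialization at `ι x`. -/
noncomputable def coordAlong (ι : M → L) (V : ∀ x : M, TangentSpace (𝓡 m) (ι x)) (x y : M) :
    EuclideanSpace ℝ (Fin m) :=
  (trivializationAt (EuclideanSpace ℝ (Fin m)) (TangentSpace (𝓡 m) : L → Type _) (ι x)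
    ⟨ι y, V y⟩).2

lemma DiffAlongAt.base (hV : DiffAlongAt (d := d) ι V x) : MDifferentiableAt (𝓡 d) (𝓡 m) ι x :=
  ((mdifferentiableAt_totalSpace _ _).1 hV).1

lemma DiffAlongAt.coord (hV : DiffAlongAt (d := d) ι V x) :
    MDifferentiableAt (𝓡 d) 𝓘(ℝ, EuclideanSpace ℝ (Fin m)) (coordAlong ι V x) x :=
  ((mdifferentiableAt_totalSpace _ _).1 hV).2

lemma coordAlong_eventually_eq (hι : ContinuousAt ι x)
    (V : ∀ x : M, TangentSpace (𝓡 m) (ι x)) : coordAlong ι V x =ᶠ[𝓝 x] fun y ↦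
      (trivializationAt (EuclideanSpace ℝ (Fin m)) (TangentSpace (𝓡 m) : L → Type _)
        (ι x)).linearMapAt ℝ (ι y) (V y) := by
  set e := trivializationAt (EuclideanSpace ℝ (Fin m)) (TangentSpace (𝓡 m) : L → Type _) (ι x)
  filter_upwards [hι (e.open_baseSet.mem_nhds (FiberBundle.mem_baseSet_trivializationAt' (ι x)))]
    with y hy
  rw [Trivialization.coe_linearMapAt_of_mem _ hy]
  rfl

lemma covAlong_apply (v : TangentSpace (𝓡 d) x) :
    covAlong cov ι V x v =
      (trivializationAt (EuclideanSpace ℝ (Fin m)) (TangentSpace (𝓡 m) : L → Type _)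
        (ι x)).symmₗ ℝ (ι x) (mvfderiv (𝓡 d) (coordAlong ι V x) x v) +
      cov (FiberBundle.extend (EuclideanSpace ℝ (Fin m)) (V x)) (ι x)
        (mfderiv (𝓡 d) (𝓡 m) ι x v) := by
  rw [Trivialization.symmₗ_apply _ (FiberBundle.mem_baseSet_trivializationAt' (ι x))]
  rfl

/-- The extensions add up only near `p`, so locality of the connection enters as well as additivity.
-/
lemma cov_extend_add {p : L} (v w : TangentSpace (𝓡 m) p) :
    cov (FiberBundle.extend (EuclideanSpace ℝ (Fin m)) (v + w)) p =
      cov (FiberBundle.extend (EuclideanSpace ℝ (Fin m)) v) p +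
        cov (FiberBundle.extend (EuclideanSpace ℝ (Fin m)) w) p := by
  have h (u : TangentSpace (𝓡 m) p) :=
    FiberBundle.mdifferentiableAt_extend (𝓡 m) (EuclideanSpace ℝ (Fin m)) u
  rw [cov.isCovariantDerivativeOnUniv.congr_of_eventuallyEq (h _)
    (mdifferentiableAt_add_section (h v) (h w)) Filter.univ_mem (extend_add_eventuallyEq v w),
    cov.isCovariantDerivativeOnUniv.add (h v) (h w)]

lemma cov_extend_smul {p : L} (a : ℝ) (v : TangentSpace (𝓡 m) p) :
    cov (FiberBundle.extend (EuclideanSpace ℝ (Fin m)) (a • v)) p =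
      a • cov (FiberBundle.extend (EuclideanSpace ℝ (Fin m)) v) p := by
  have h (u : TangentSpace (𝓡 m) p) :=
    FiberBundle.mdifferentiableAt_extend (𝓡 m) (EuclideanSpace ℝ (Fin m)) u
  rw [cov.isCovariantDerivativeOnUniv.congr_of_eventuallyEq (h _)
    ((h v).smul_const_section) Filter.univ_mem (extend_smul_eventuallyEq a v),
    cov.isCovariantDerivativeOnUniv.smul_const a (h v)]

lemma covAlong_map_add (v w : TangentSpace (𝓡 d) x) :
    covAlong cov ι V x (v + w) = covAlong cov ι V x v + covAlong cov ι V x w := by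
  simp only [covAlong_apply, map_add]
  abel

lemma covAlong_map_smul (a : ℝ) (v : TangentSpace (𝓡 d) x) :
    covAlong cov ι V x (a • v) = a • covAlong cov ι V x v := by
  simp only [covAlong_apply, map_smul, smul_add]

lemma covAlong_add (hV : DiffAlongAt (d := d) ι V x) (hW : DiffAlongAt (d := d) ι W x)
    (v : TangentSpace (𝓡 d) x) :
    covAlong cov ι (fun y ↦ V y + W y) x v = covAlong cov ι V x v + covAlong cov ι W x v := by
  have h : coordAlong ι (fun y ↦ V y + W y) x =ᶠ[𝓝 x] coordAlong ι V x + coordAlong ι W x := by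
    have hι := hV.base.continuousAt
    filter_upwards [coordAlong_eventually_eq hι V, coordAlong_eventually_eq hι W,
      coordAlong_eventually_eq hι (fun y ↦ V y + W y)] with y h1 h2 h3
    rw [h3, Pi.add_apply, h1, h2, map_add]
  simp only [covAlong_apply]
  rw [mvfderiv_congr_of_eventuallyEq h, mvfderiv_add hV.coord hW.coord, cov_extend_add]
  simp only [add_apply, map_add]
  abel

lemma covAlong_smul {f : M → ℝ} (hf : MDifferentiableAt (𝓡 d) 𝓘(ℝ) f x)
    (hV : DiffAlongAt (d := d) ι V x) (v : TangentSpace (𝓡 d) x) :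
    covAlong cov ι (fun y ↦ f y • V y) x v =
      f x • covAlong cov ι V x v + mvfderiv (𝓡 d) f x v • V x := by
  have hι := hV.base.continuousAt
  have h : coordAlong ι (fun y ↦ f y • V y) x =ᶠ[𝓝 x] f • coordAlong ι V x := by
    filter_upwards [coordAlong_eventually_eq hι V,
      coordAlong_eventually_eq hι (fun y ↦ f y • V y)] with y h1 h3
    rw [h3, Pi.smul_apply', h1, map_smul]
  -- In the Leibniz rule for the components, the term `df(v)` times the components of `V` returns to
  -- `df(v) • V x` under the inverse trivialization. The connection term only sees the number `f x`.
  have h0 := (coordAlong_eventually_eq hι V).self_of_nhds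
  simp only [covAlong_apply]
  rw [mvfderiv_congr_of_eventuallyEq h, mvfderiv_smul hf hV.coord, cov_extend_smul]
  simp only [add_apply, smul_apply, map_add, map_smul, ContinuousLinearMap.smulRight_apply, h0,
    Trivialization.symmₗ_linearMapAt _ (FiberBundle.mem_baseSet_trivializationAt' (ι x)), smul_add]
  abel

variable (G : LorentzMetric m L)

lemma mdifferentiableAt_metric_along (hV : DiffAlongAt (d := d) ι V x)
    (hW : DiffAlongAt (d := d) ι W x) :
    MDifferentiableAt (𝓡 d) 𝓘(ℝ) (fun y ↦ G.val (ι y) (V y) (W y)) x := by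
  have h : MDifferentiableAt (𝓡 d) ((𝓡 m).prod 𝓘(ℝ))
      (fun y ↦ TotalSpace.mk' ℝ (E := Bundle.Trivial L ℝ) (ι y) (G.val (ι y) (V y) (W y))) x := by
    apply MDifferentiableAt.clm_bundle_apply₂ (F₁ := EuclideanSpace ℝ (Fin m))
      (F₂ := EuclideanSpace ℝ (Fin m))
    · exact ((G.contMDiff (ι x)).mdifferentiableAt (by simp)).comp x hV.base
    · exact hV
    · exact hW
  rw [mdifferentiableAt_totalSpace] at h
  exact h.2

variable {G cov}

/-- The components of a Lorentzian metric in the preferred trivialization at `p`. -/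
noncomputable def metricCoord (G : LorentzMetric m L) (p q : L) :
    EuclideanSpace ℝ (Fin m) →L[ℝ] EuclideanSpace ℝ (Fin m) →L[ℝ] ℝ :=
  ContinuousLinearMap.inCoordinates (EuclideanSpace ℝ (Fin m)) (TangentSpace (𝓡 m) : L → Type _)
    (EuclideanSpace ℝ (Fin m) →L[ℝ] ℝ)
    (fun q : L ↦ TangentSpace (𝓡 m) q →L[ℝ] (Bundle.Trivial L ℝ) q) p q p q (G.val q)

lemma mdifferentiableAt_metricCoord (p : L) :
    MDifferentiableAt (𝓡 m) 𝓘(ℝ, EuclideanSpace ℝ (Fin m) →L[ℝ] EuclideanSpace ℝ (Fin m) →L[ℝ] ℝ)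
      (metricCoord G p) p :=
  ((mdifferentiableAt_hom_bundle
    (E₂ := fun q : L ↦ TangentSpace (𝓡 m) q →L[ℝ] (Bundle.Trivial L ℝ) q) _).1
    ((G.contMDiff p).mdifferentiableAt (by simp))).2

lemma metricCoord_apply {p q : L} (hq : q ∈ (trivializationAt (EuclideanSpace ℝ (Fin m))
      (TangentSpace (𝓡 m) : L → Type _) p).baseSet) (a b : EuclideanSpace ℝ (Fin m)) :
    metricCoord G p q a b = G.val q
      ((trivializationAt (EuclideanSpace ℝ (Fin m)) (TangentSpace (𝓡 m) : L → Type _) p).symm q a)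
      ((trivializationAt (EuclideanSpace ℝ (Fin m)) (TangentSpace (𝓡 m) : L → Type _) p).symm q b)
      := by
  unfold metricCoord
  rw [inCoordinates_apply_eq₂ hq hq (by simp)]
  simp

/-- In the trivialization, the product rule yields two terms with differentiated components and one
with a differentiated metric matrix. The latter is accounted for by metricity of `∇̄` on extensions
with constant components. -/
lemma covAlong_metric (hcov : IsLeviCivita G cov) (hV : DiffAlongAt (d := d) ι V x)
    (hW : DiffAlongAt (d := d) ι W x) (v : TangentSpace (𝓡 d) x) :
    mvfderiv (𝓡 d) (fun y ↦ G.val (ι y) (V y) (W y)) x v =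
      G.val (ι x) (covAlong cov ι V x v) (W x) + G.val (ι x) (V x) (covAlong cov ι W x v) := by
  set e := trivializationAt (EuclideanSpace ℝ (Fin m)) (TangentSpace (𝓡 m) : L → Type _) (ι x)
    with he
  have hι := hV.base.continuousAt
  have hx : ι x ∈ e.baseSet := FiberBundle.mem_baseSet_trivializationAt' (ι x)
  have hB := mdifferentiableAt_metricCoord (G := G) (ι x)
  have hBι : MDifferentiableAt (𝓡 d)
      𝓘(ℝ, EuclideanSpace ℝ (Fin m) →L[ℝ] EuclideanSpace ℝ (Fin m) →L[ℝ] ℝ)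
      (fun y ↦ metricCoord G (ι x) (ι y)) x := hB.comp x hV.base
  have hsymm (Z : ∀ x : M, TangentSpace (𝓡 m) (ι x)) (y : M) (hy : ι y ∈ e.baseSet) :
      e.symm (ι y) (coordAlong ι Z x y) = Z y := by
    simp only [coordAlong, ← he]
    exact Trivialization.symm_apply_apply_mk _ hy _
  have h1 : (fun y ↦ G.val (ι y) (V y) (W y)) =ᶠ[𝓝 x]
      fun y ↦ metricCoord G (ι x) (ι y) (coordAlong ι V x y) (coordAlong ι W x y) := by
    filter_upwards [hι (e.open_baseSet.mem_nhds hx)] with y hy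
    rw [metricCoord_apply hy, ← he, hsymm V y hy, hsymm W y hy]
  -- With constant components, only the metric matrix varies; the chain rule transfers its
  -- derivative from `L` to `M`.
  have h2 : mvfderiv (𝓡 m) (fun q ↦ G.val q
        (FiberBundle.extend (EuclideanSpace ℝ (Fin m)) (V x) q)
        (FiberBundle.extend (EuclideanSpace ℝ (Fin m)) (W x) q)) (ι x)
        (mfderiv (𝓡 d) (𝓡 m) ι x v) =
      mvfderiv (𝓡 d) (fun y ↦ metricCoord G (ι x) (ι y)) x v
        (coordAlong ι V x x) (coordAlong ι W x x) := by
    have h3 : (fun q ↦ G.val q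
        (FiberBundle.extend (EuclideanSpace ℝ (Fin m)) (V x) q)
        (FiberBundle.extend (EuclideanSpace ℝ (Fin m)) (W x) q)) =ᶠ[𝓝 (ι x)] fun q ↦
        metricCoord G (ι x) q (coordAlong ι V x x) (coordAlong ι W x x) := by
      filter_upwards [e.open_baseSet.mem_nhds hx] with q hq
      rw [metricCoord_apply hq]
      rfl
    rw [mvfderiv_congr_of_eventuallyEq h3]
    rw [mvfderiv_clm_apply (hB.clm_apply mdifferentiableAt_const) mdifferentiableAt_const,
      mvfderiv_clm_apply hB mdifferentiableAt_const, mvfderiv_const, mvfderiv_const]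
    have h4 : mvfderiv (𝓡 d) (fun y ↦ metricCoord G (ι x) (ι y)) x v =
        mvfderiv (𝓡 m) (metricCoord G (ι x)) (ι x) (mfderiv (𝓡 d) (𝓡 m) ι x v) :=
      mfderiv_comp_apply x hB hV.base v
    rw [h4]
    simp
  have h5 := hcov.metric (FiberBundle.mdifferentiableAt_extend (𝓡 m) (EuclideanSpace ℝ (Fin m)) (V x))
    (FiberBundle.mdifferentiableAt_extend (𝓡 m) (EuclideanSpace ℝ (Fin m)) (W x))
    (mfderiv (𝓡 d) (𝓡 m) ι x v)
  rw [h2, FiberBundle.extend_apply_self, FiberBundle.extend_apply_self] at h5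
  rw [mvfderiv_congr_of_eventuallyEq h1,
    mvfderiv_clm_apply (hBι.clm_apply hV.coord) hW.coord, mvfderiv_clm_apply hBι hV.coord,
    add_apply, h5, metricCoord_apply hx, metricCoord_apply hx, ← he, hsymm V x hx, hsymm W x hx]
  simp only [covAlong_apply, ← he, Trivialization.symmₗ_apply _ hx, map_add, add_apply]
  ring

end Along

end Lightlike

namespace Lightlike

namespace LightlikeHypersurface

variable {n : ℕ} {L : Type*} [TopologicalSpace L]
  [ChartedSpace (EuclideanSpace ℝ (Fin (n + 2))) L] [IsManifold (𝓡 (n + 2)) ∞ L]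
  {M : Type*} [TopologicalSpace M] [ChartedSpace (EuclideanSpace ℝ (Fin (n + 1))) M]
  [IsManifold (𝓡 (n + 1)) ∞ M]
  {G : LorentzMetric (n + 2) L} (H : LightlikeHypersurface M G)
  (cov : CovariantDerivative (𝓡 (n + 2)) (EuclideanSpace ℝ (Fin (n + 2)))
    (TangentSpace (𝓡 (n + 2)) : L → Type _))

/-- Smoothness of a vector field at a point. -/
abbrev SmoothFieldAt (X : ∀ x : M, TangentSpace (𝓡 (n + 1)) x) (x : M) : Prop :=
  ContMDiffAt (𝓡 (n + 1)) (𝓡 (n + 1)).tangent ∞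
    (fun y ↦ (⟨y, X y⟩ : TangentBundle (𝓡 (n + 1)) M)) x

/-- Differentiability of a vector field at a point. -/
abbrev DiffFieldAt (X : ∀ x : M, TangentSpace (𝓡 (n + 1)) x) (x : M) : Prop :=
  MDifferentiableAt (𝓡 (n + 1)) (𝓡 (n + 1)).tangent
    (fun y ↦ (⟨y, X y⟩ : TangentBundle (𝓡 (n + 1)) M)) x

/-- Smoothness of a field of endomorphisms. -/
abbrev SmoothEnd (S : ∀ x : M, TangentSpace (𝓡 (n + 1)) x →L[ℝ] TangentSpace (𝓡 (n + 1)) x) :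
    Prop :=
  ContMDiff (𝓡 (n + 1))
    ((𝓡 (n + 1)).prod 𝓘(ℝ, EuclideanSpace ℝ (Fin (n + 1)) →L[ℝ] EuclideanSpace ℝ (Fin (n + 1)))) ∞
    (fun x ↦ TotalSpace.mk' (EuclideanSpace ℝ (Fin (n + 1)) →L[ℝ] EuclideanSpace ℝ (Fin (n + 1)))
      (E := fun x : M ↦ TangentSpace (𝓡 (n + 1)) x →L[ℝ] TangentSpace (𝓡 (n + 1)) x) x (S x))

variable {X Y : ∀ x : M, TangentSpace (𝓡 (n + 1)) x} {x : M}

lemma SmoothFieldAt.diff (hX : SmoothFieldAt X x) : DiffFieldAt X x :=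
  hX.mdifferentiableAt (by simp)

/-! ### Smoothness of `η`, `P` and of images under `S`. -/

section Smoothness

lemma diffAlongAt_dι (hX : DiffFieldAt X x) :
    DiffAlongAt (d := n + 1) H.ι (fun y ↦ H.dι y (X y)) x := by
  have h : ContMDiff (𝓡 (n + 1)).tangent (𝓡 (n + 2)).tangent 1
      (tangentMap (𝓡 (n + 1)) (𝓡 (n + 2)) H.ι) :=
    H.contMDiff_ι.contMDiff_tangentMap (by norm_cast)
  exact ((h ⟨x, X x⟩).mdifferentiableAt (by simp)).comp x hX

lemma contMDiffAt_dι (hX : SmoothFieldAt X x) :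
    ContMDiffAt (𝓡 (n + 1)) (𝓡 (n + 2)).tangent ∞
      (fun y ↦ (⟨H.ι y, H.dι y (X y)⟩ : TangentBundle (𝓡 (n + 2)) L)) x := by
  have h : ContMDiff (𝓡 (n + 1)).tangent (𝓡 (n + 2)).tangent ∞
      (tangentMap (𝓡 (n + 1)) (𝓡 (n + 2)) H.ι) :=
    H.contMDiff_ι.contMDiff_tangentMap (by norm_cast)
  exact (h ⟨x, X x⟩).comp x hX

lemma mdifferentiableAt_η (hX : DiffFieldAt X x) :
    MDifferentiableAt (𝓡 (n + 1)) 𝓘(ℝ) (fun y ↦ H.η y (X y)) x :=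
  mdifferentiableAt_metric_along G ((H.contMDiff_N x).mdifferentiableAt (by simp))
    (H.diffAlongAt_dι hX)

lemma contMDiffAt_η (hX : SmoothFieldAt X x) :
    ContMDiffAt (𝓡 (n + 1)) 𝓘(ℝ) ∞ (fun y ↦ H.η y (X y)) x := by
  have h : ContMDiffAt (𝓡 (n + 1)) ((𝓡 (n + 2)).prod 𝓘(ℝ)) ∞
      (fun y ↦ TotalSpace.mk' ℝ (E := Bundle.Trivial L ℝ) (H.ι y)
        (G.val (H.ι y) (H.N y) (H.dι y (X y)))) x := by
    apply ContMDiffAt.clm_bundle_apply₂ (F₁ := EuclideanSpace ℝ (Fin (n + 2)))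
      (F₂ := EuclideanSpace ℝ (Fin (n + 2)))
    · exact (G.contMDiff (H.ι x)).comp x (H.contMDiff_ι x)
    · exact H.contMDiff_N x
    · exact H.contMDiffAt_dι hX
  rw [contMDiffAt_totalSpace] at h
  exact h.2

lemma P_mem_screen (x : M) (v : TangentSpace (𝓡 (n + 1)) x) : H.P x v ∈ H.screen x :=
  Submodule.projection_apply_mem _ v

lemma P_of_mem_screen {x : M} {v : TangentSpace (𝓡 (n + 1)) x} (hv : v ∈ H.screen x) :
    H.P x v = v :=
  Submodule.projection_apply_of_mem_left (H.isCompl_screen x) hv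

/-- The radical is the line of `ξ`, and `η` reads off the coefficient: it vanishes on the screen and
is `1` on `ξ`. Smoothness of `P` follows from that of `η` and `ξ`. -/
lemma eq_P_add (x : M) (v : TangentSpace (𝓡 (n + 1)) x) : v = H.P x v + H.η x v • H.ξ x := by
  have h1 : v - H.P x v ∈ H.rad x := by
    have h2 : H.P x (v - H.P x v) = 0 := by
      rw [map_sub, H.P_of_mem_screen (H.P_mem_screen x v), sub_self]
    exact (Submodule.projection_apply_eq_zero_iff _).1 h2
  rw [rad_eq_span, Submodule.mem_span_singleton] at h1
  obtain ⟨c, hc⟩ := h1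
  have h3 : v = H.P x v + c • H.ξ x := by rw [hc]; abel
  have h4 : H.η x v = c := by
    rw [h3, map_add, H.η_screen x (H.P_mem_screen x v), map_smul, η_ξ]
    simp
  rwa [h4]

lemma P_apply (x : M) (v : TangentSpace (𝓡 (n + 1)) x) : H.P x v = v - H.η x v • H.ξ x :=
  eq_sub_of_add_eq (H.eq_P_add x v).symm

lemma diffFieldAt_P (hX : DiffFieldAt X x) : DiffFieldAt (fun y ↦ H.P y (X y)) x := by
  simp only [P_apply]
  exact mdifferentiableAt_sub_section hX
    ((H.mdifferentiableAt_η hX).smul_section (SmoothFieldAt.diff (H.contMDiff_ξ x)))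

lemma smoothFieldAt_P (hX : SmoothFieldAt X x) : SmoothFieldAt (fun y ↦ H.P y (X y)) x := by
  simp only [P_apply]
  exact ContMDiffAt.sub_section hX ((H.contMDiffAt_η hX).smul_section (H.contMDiff_ξ x))

variable {S : ∀ x : M, TangentSpace (𝓡 (n + 1)) x →L[ℝ] TangentSpace (𝓡 (n + 1)) x}

lemma SmoothFieldAt.end_apply (hS : SmoothEnd S) (hX : SmoothFieldAt X x) :
    SmoothFieldAt (fun y ↦ S y (X y)) x :=
  ContMDiffAt.clm_bundle_apply (b := fun y : M ↦ y) (hS x) hX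

lemma DiffFieldAt.end_apply (hS : SmoothEnd S) (hX : DiffFieldAt X x) :
    DiffFieldAt (fun y ↦ S y (X y)) x :=
  MDifferentiableAt.clm_bundle_apply (b := fun y : M ↦ y) ((hS x).mdifferentiableAt (by simp)) hX

lemma smoothFieldAt_extend (v : TangentSpace (𝓡 (n + 1)) x) :
    SmoothFieldAt (FiberBundle.extend (EuclideanSpace ℝ (Fin (n + 1))) v) x :=
  FiberBundle.contMDiffAt_extend ..

end Smoothness

/-! ### The induced connection, and tensoriality of `∇S` and of the screen form `C`. -/

section Connection

lemma Q_dι (v : TangentSpace (𝓡 (n + 1)) x) : H.Q x (H.dι x v) = v :=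
  LinearMap.linearProjOfIsCompl_apply_left ..

lemma nabla_map_add (v w : TangentSpace (𝓡 (n + 1)) x) :
    H.nabla cov X x (v + w) = H.nabla cov X x v + H.nabla cov X x w := by
  simp only [nabla, ambientNabla, covAlong_map_add, map_add]

lemma nabla_map_smul (a : ℝ) (v : TangentSpace (𝓡 (n + 1)) x) :
    H.nabla cov X x (a • v) = a • H.nabla cov X x v := by
  simp only [nabla, ambientNabla, covAlong_map_smul, map_smul]

lemma nabla_add (hX : DiffFieldAt X x) (hY : DiffFieldAt Y x) (v : TangentSpace (𝓡 (n + 1)) x) :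
    H.nabla cov (fun y ↦ X y + Y y) x v = H.nabla cov X x v + H.nabla cov Y x v := by
  simp only [nabla, ambientNabla, map_add]
  rw [covAlong_add cov (H.diffAlongAt_dι hX) (H.diffAlongAt_dι hY), map_add]

lemma nabla_smul {f : M → ℝ} (hf : MDifferentiableAt (𝓡 (n + 1)) 𝓘(ℝ) f x)
    (hX : DiffFieldAt X x) (v : TangentSpace (𝓡 (n + 1)) x) :
    H.nabla cov (fun y ↦ f y • X y) x v =
      f x • H.nabla cov X x v + mvfderiv (𝓡 (n + 1)) f x v • X x := by
  simp only [nabla, ambientNabla, map_smul]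
  rw [covAlong_smul cov hf (H.diffAlongAt_dι hX), map_add, map_smul, map_smul, Q_dι]

lemma nabla_congr_of_eventuallyEq (h : ∀ᶠ y in 𝓝 x, X y = Y y)
    (v : TangentSpace (𝓡 (n + 1)) x) : H.nabla cov X x v = H.nabla cov Y x v := by
  have hc : coordAlong H.ι (fun y ↦ H.dι y (X y)) x =ᶠ[𝓝 x]
      coordAlong H.ι (fun y ↦ H.dι y (Y y)) x := by
    filter_upwards [h] with y hy
    simp only [coordAlong, hy]
  simp only [nabla, ambientNabla, covAlong_apply, mvfderiv_congr_of_eventuallyEq hc,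
    h.self_of_nhds]

variable {H cov}

lemma dι_nabla (hH : H.IsTotallyGeodesic cov) (hX : SmoothFieldAt X x)
    (v : TangentSpace (𝓡 (n + 1)) x) :
    H.dι x (H.nabla cov X x v) = covAlong cov H.ι (fun y ↦ H.dι y (X y)) x v :=
  (sub_eq_zero.1 (hH x X hX v)).symm

/-- Total geodesy removes the projection `Q`, so metricity is inherited from `∇̄`. -/
lemma mvfderiv_g (hcov : IsLeviCivita G cov) (hH : H.IsTotallyGeodesic cov)
    (hX : SmoothFieldAt X x) (hY : SmoothFieldAt Y x) (v : TangentSpace (𝓡 (n + 1)) x) :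
    mvfderiv (𝓡 (n + 1)) (fun y ↦ H.g y (X y) (Y y)) x v =
      H.g x (H.nabla cov X x v) (Y x) + H.g x (X x) (H.nabla cov Y x v) := by
  rw [g_apply, g_apply, dι_nabla hH hX, dι_nabla hH hY]
  exact covAlong_metric hcov (H.diffAlongAt_dι hX.diff) (H.diffAlongAt_dι hY.diff) v

variable {S : ∀ x : M, TangentSpace (𝓡 (n + 1)) x →L[ℝ] TangentSpace (𝓡 (n + 1)) x}

variable (H cov) in
-- The two derivative terms `df(v) • S W` and `S (df(v) • W)` cancel. Hence the extension fixed in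
-- `nablaEnd` may be replaced by any other, in particular by a field of eigenvectors.
lemma tensorialAt_nablaEnd (hS : SmoothEnd S) (v : TangentSpace (𝓡 (n + 1)) x) :
    TensorialAt (𝓡 (n + 1)) (EuclideanSpace ℝ (Fin (n + 1)))
      (fun W : ∀ x : M, TangentSpace (𝓡 (n + 1)) x ↦
        H.nabla cov (fun y ↦ S y (W y)) x v - S x (H.nabla cov W x v)) x where
  smul {f W} hf hW := by
    change H.nabla cov (fun y ↦ S y (f y • W y)) x v - S x (H.nabla cov (fun y ↦ f y • W y) x v) = _
    simp only [map_smul]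
    rw [H.nabla_smul cov hf (DiffFieldAt.end_apply hS hW), H.nabla_smul cov hf hW, map_add,
      map_smul, map_smul, smul_sub]
    abel
  add {W W'} hW hW' := by
    change H.nabla cov (fun y ↦ S y (W y + W' y)) x v - S x (H.nabla cov (fun y ↦ W y + W' y) x v)
      = _
    simp only [map_add]
    rw [H.nabla_add cov (DiffFieldAt.end_apply hS hW) (DiffFieldAt.end_apply hS hW'),
      H.nabla_add cov hW hW', map_add]
    abel

variable (H cov) in
lemma nablaEnd_apply (hS : SmoothEnd S) (hX : DiffFieldAt X x) (v : TangentSpace (𝓡 (n + 1)) x) :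
    H.nablaEnd cov S x v (X x) =
      H.nabla cov (fun y ↦ S y (X y)) x v - S x (H.nabla cov X x v) :=
  (H.tensorialAt_nablaEnd cov hS v).pointwise (smoothFieldAt_extend _).diff hX (by simp)

variable (H cov) in
lemma nablaEnd_add_right (hS : SmoothEnd S) (v w w' : TangentSpace (𝓡 (n + 1)) x) :
    H.nablaEnd cov S x v (w + w') = H.nablaEnd cov S x v w + H.nablaEnd cov S x v w' :=
  map_add ((H.tensorialAt_nablaEnd cov hS v).mkHom _ x) w w'

variable (H cov) in
lemma nablaEnd_add_left (v v' w : TangentSpace (𝓡 (n + 1)) x) :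
    H.nablaEnd cov S x (v + v') w = H.nablaEnd cov S x v w + H.nablaEnd cov S x v' w := by
  simp only [nablaEnd, nabla_map_add, map_add]
  abel

variable (H cov) in
lemma nablaEnd_smul_right (hS : SmoothEnd S) (a : ℝ) (v w : TangentSpace (𝓡 (n + 1)) x) :
    H.nablaEnd cov S x v (a • w) = a • H.nablaEnd cov S x v w :=
  map_smul ((H.tensorialAt_nablaEnd cov hS v).mkHom _ x) a w

variable (H cov) in
lemma nablaEnd_smul_left (a : ℝ) (v w : TangentSpace (𝓡 (n + 1)) x) :
    H.nablaEnd cov S x (a • v) w = a • H.nablaEnd cov S x v w := by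
  simp only [nablaEnd, nabla_map_smul, map_smul, smul_sub]

variable (H cov) in
-- The derivative term `df(v) • P W` is screen-valued, so `η` kills it.
lemma tensorialAt_η_nabla_P (v : TangentSpace (𝓡 (n + 1)) x) :
    TensorialAt (𝓡 (n + 1)) (EuclideanSpace ℝ (Fin (n + 1)))
      (fun W : ∀ x : M, TangentSpace (𝓡 (n + 1)) x ↦
        H.η x (H.nabla cov (fun y ↦ H.P y (W y)) x v)) x where
  smul {f W} hf hW := by
    change H.η x (H.nabla cov (fun y ↦ H.P y (f y • W y)) x v) = _
    simp only [map_smul]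
    rw [H.nabla_smul cov hf (H.diffFieldAt_P hW), map_add, map_smul, map_smul,
      H.η_screen x (H.P_mem_screen x _), smul_zero, add_zero]
  add {W W'} hW hW' := by
    change H.η x (H.nabla cov (fun y ↦ H.P y (W y + W' y)) x v) = _
    simp only [map_add]
    rw [H.nabla_add cov (H.diffFieldAt_P hW) (H.diffFieldAt_P hW'), map_add]

variable (H cov) in
/-- The second fundamental form of the screen computed with a screen-valued extension. -/
lemma C_apply (hX : DiffFieldAt X x) (hscreen : ∀ᶠ y in 𝓝 x, X y ∈ H.screen y)
    (v : TangentSpace (𝓡 (n + 1)) x) : H.C cov x v (X x) = H.η x (H.nabla cov X x v) := by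
  have h1 := (H.tensorialAt_η_nabla_P cov v).pointwise
    (smoothFieldAt_extend (X x)).diff hX (by simp)
  have h2 : H.nabla cov (fun y ↦ H.P y (X y)) x v = H.nabla cov X x v :=
    H.nabla_congr_of_eventuallyEq cov (hscreen.mono fun y hy ↦ H.P_of_mem_screen hy) v
  rw [h2] at h1
  rw [← h1]
  simp only [C, map_sub, H.η_screen x (H.P_mem_screen x _), sub_zero]

end Connection

end LightlikeHypersurface

end Lightlike

namespace Lightlike

/-! ### Diagonalization and positivity in linear algebra. -/

section LinearAlgebra

variable {V : Type*} [AddCommGroup V] [Module ℝ V]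

/-- An endomorphism that is symmetric for a positive definite form is diagonalizable. -/
lemma iSup_eigenspace_eq_top_of_symm [FiniteDimensional ℝ V] (B : V →ₗ[ℝ] V →ₗ[ℝ] ℝ)
    (hsymm : ∀ v w, B v w = B w v) (hpos : ∀ v, v ≠ 0 → 0 < B v v) (T : Module.End ℝ V)
    (hT : ∀ v w, B (T v) w = B v (T w)) : ⨆ μ, Module.End.eigenspace T μ = ⊤ := by
  -- The form becomes a local inner product, for which the spectral theorem is available.
  let core : InnerProductSpace.Core ℝ V :=
    { inner := fun v w ↦ B v w
      conj_inner_symm := fun v w ↦ hsymm w v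
      re_inner_nonneg := fun v ↦ by
        rcases eq_or_ne v 0 with rfl | hv
        · simp
        · exact (hpos v hv).le
      add_left := fun u v w ↦ by simp
      smul_left := fun u v r ↦ by simp
      definite := fun v hv ↦ by
        by_contra h
        exact (hpos v h).ne' hv }
  let : NormedAddCommGroup V := core.toNormedAddCommGroup
  let : InnerProductSpace ℝ V := InnerProductSpace.ofCore core.toCore
  have h : T.IsSymmetric := fun v w ↦ hT v w
  exact Submodule.orthogonal_eq_bot_iff.1 h.orthogonalComplement_iSup_eigenspaces_eq_bot

open Polynomial in
/-- A polynomial vanishing at all eigenvalues of an endomorphism on an invariant subspace, on which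
it is symmetric for a positive definite form, kills that subspace. -/
lemma aeval_apply_eq_zero_of_symm [FiniteDimensional ℝ V] (B : V →ₗ[ℝ] V →ₗ[ℝ] ℝ)
    (hsymm : ∀ v w, B v w = B w v) (T : Module.End ℝ V)
    (hT : ∀ v w, B (T v) w = B v (T w)) (K : Submodule ℝ V) (hK : ∀ v ∈ K, T v ∈ K)
    (hpos : ∀ v ∈ K, v ≠ 0 → 0 < B v v) (p : ℝ[X])
    (hp : ∀ μ, ∀ v ∈ K, v ≠ 0 → T v = μ • v → p.eval μ = 0) {v : V} (hv : v ∈ K) :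
    aeval T p v = 0 := by
  have h := iSup_eigenspace_eq_top_of_symm (B.domRestrict₁₂ K K) (fun v w ↦ hsymm v w)
    (fun v hv ↦ hpos v v.2 (by simpa using hv)) (T.restrict hK) (fun v w ↦ hT v w)
  have h2 : (⨆ μ, Module.End.eigenspace (T.restrict hK) μ) ≤
      LinearMap.ker ((aeval T p).comp K.subtype) := by
    refine iSup_le fun μ w hw ↦ ?_
    have hw' : T w = μ • (w : V) := by
      have := Module.End.mem_eigenspace_iff.1 hw
      exact congrArg Subtype.val this
    rcases eq_or_ne (w : V) 0 with h0 | h0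
    · simp [h0]
    · have : T.HasEigenvector μ w := Module.End.hasEigenvector_iff.2
        ⟨Module.End.mem_eigenspace_iff.2 hw', h0⟩
      simp [Module.End.aeval_apply_of_hasEigenvector this, hp μ w w.2 h0 hw']
  have h3 := h2 (show (⟨v, hv⟩ : K) ∈ _ by rw [h]; trivial)
  simpa using h3

open Polynomial in
lemma aeval_prod_X_sub_C_apply {ι : Type*} (s : Finset ι) (c : ι → ℝ) (T : Module.End ℝ V)
    {μ : ℝ} {v : V} (hv : T v = μ • v) :
    aeval T (∏ j ∈ s, (X - C (c j))) v = (∏ j ∈ s, (μ - c j)) • v := by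
  rcases eq_or_ne v 0 with rfl | h0
  · simp
  · have : T.HasEigenvector μ v := Module.End.hasEigenvector_iff.2
      ⟨Module.End.mem_eigenspace_iff.2 hv, h0⟩
    rw [Module.End.aeval_apply_of_hasEigenvector this, eval_prod]
    simp

open Polynomial in
-- Splitting off one factor drives the inductions on the product and isolates the factor `S - λ_i`
-- later.
lemma aeval_prod_insert_apply {ι : Type*} [DecidableEq ι] {s : Finset ι} {a : ι} (ha : a ∉ s)
    (c : ι → ℝ) (T : Module.End ℝ V) (v : V) :
    aeval T (∏ j ∈ insert a s, (X - C (c j))) v =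
      T (aeval T (∏ j ∈ s, (X - C (c j))) v) - c a • aeval T (∏ j ∈ s, (X - C (c j))) v := by
  rw [Finset.prod_insert ha, map_mul, Module.End.mul_apply]
  simp

end LinearAlgebra

/-- In a Lorentzian vector space a vector orthogonal to a null vector `z ≠ 0` is spacelike unless
it is a multiple of `z`. -/
lemma LorentzMetric.pos_of_orthogonal_null {m : ℕ} {L : Type*} [TopologicalSpace L]
    [ChartedSpace (EuclideanSpace ℝ (Fin m)) L] [IsManifold (𝓡 m) ∞ L] (G : LorentzMetric m L)
    {p : L} {z u : TangentSpace (𝓡 m) p} (hz : z ≠ 0) (hzz : G.val p z z = 0)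
    (hzu : G.val p z u = 0) (hu : ∀ c : ℝ, u ≠ c • z) : 0 < G.val p u u := by
  obtain ⟨t, -, ht⟩ := G.lorentzian p
  have ha : G.val p t z ≠ 0 := fun h ↦ (ht z h hz).ne' hzz
  -- Subtracting a multiple of `z` makes the vector orthogonal to the timelike `t` without changing
  -- its square, because `z` is null and orthogonal to `u`.
  have h1 := ht (u - (G.val p t u / G.val p t z) • z)
    (by rw [map_sub, map_smul, smul_eq_mul, div_mul_cancel₀ _ ha, sub_self])
    (sub_ne_zero.2 (hu _))
  simpa [hzz, hzu, G.symm p u z] using h1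

namespace LightlikeHypersurface

variable {n : ℕ} {L : Type*} [TopologicalSpace L]
  [ChartedSpace (EuclideanSpace ℝ (Fin (n + 2))) L] [IsManifold (𝓡 (n + 2)) ∞ L]
  {M : Type*} [TopologicalSpace M] [ChartedSpace (EuclideanSpace ℝ (Fin (n + 1))) M]
  [IsManifold (𝓡 (n + 1)) ∞ M]
  {G : LorentzMetric (n + 2) L} (H : LightlikeHypersurface M G)
  {cov : CovariantDerivative (𝓡 (n + 2)) (EuclideanSpace ℝ (Fin (n + 2)))
    (TangentSpace (𝓡 (n + 2)) : L → Type _)} {x : M}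

lemma g_comm (v w : TangentSpace (𝓡 (n + 1)) x) : H.g x v w = H.g x w v := by
  rw [g_apply, g_apply, G.symm]

lemma g_ξ_left (v : TangentSpace (𝓡 (n + 1)) x) : H.g x (H.ξ x) v = 0 := by
  rw [g_comm, g_ξ]

/-- Tangent vectors are orthogonal to the null vector `ξ`, and `η` prevents a nonzero screen vector
from being a multiple of `ξ`. -/
lemma g_pos_of_mem_screen {v : TangentSpace (𝓡 (n + 1)) x} (hv : v ∈ H.screen x) (h0 : v ≠ 0) :
    0 < H.g x v v := by
  refine G.pos_of_orthogonal_null (z := H.dι x (H.ξ x)) ?_ (H.g_ξ x _) (H.g_ξ_left v) ?_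
  · intro h
    exact H.ξ_ne_zero x (H.injective_dι x (h.trans (map_zero (H.dι x)).symm))
  · intro c h
    rw [← map_smul] at h
    have h1 : v = c • H.ξ x := H.injective_dι x h
    have h2 := H.η_screen x hv
    rw [h1, map_smul, η_ξ, smul_eq_mul, mul_one] at h2
    exact h0 (by rw [h1, h2, zero_smul])

/-! ### Symmetry of `∇S` and polarization of the tensor condition. -/

section Endomorphism

variable {H} {S : ∀ x : M, TangentSpace (𝓡 (n + 1)) x →L[ℝ] TangentSpace (𝓡 (n + 1)) x}

/-- Obtained by differentiating `⟨S W, U⟩ = ⟨W, S U⟩` with the metric connection `∇`. -/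
lemma g_nablaEnd_symm (hcov : IsLeviCivita G cov) (hH : H.IsTotallyGeodesic cov)
    (hS : SmoothEnd S) (hsymm : ∀ x v w, H.g x (S x v) w = H.g x v (S x w))
    (v w u : TangentSpace (𝓡 (n + 1)) x) :
    H.g x (H.nablaEnd cov S x v w) u = H.g x w (H.nablaEnd cov S x v u) := by
  set W := FiberBundle.extend (EuclideanSpace ℝ (Fin (n + 1))) w with hW
  set U := FiberBundle.extend (EuclideanSpace ℝ (Fin (n + 1))) u with hU
  have hWs : SmoothFieldAt W x := smoothFieldAt_extend w
  have hUs : SmoothFieldAt U x := smoothFieldAt_extend u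
  have hWx : W x = w := by simp [hW]
  have hUx : U x = u := by simp [hU]
  have h1 := mvfderiv_g hcov hH (SmoothFieldAt.end_apply hS hWs) hUs v
  have h2 := mvfderiv_g hcov hH hWs (SmoothFieldAt.end_apply hS hUs) v
  simp only [hsymm] at h1
  rw [h1, hWx, hUx] at h2
  simp only [nablaEnd, ← hW, ← hU, map_sub, LinearMap.sub_apply, hsymm]
  linear_combination h2

/-- The derivative of `S` on a local field of eigenvectors. -/
lemma nablaEnd_eigen (hS : SmoothEnd S) {W : ∀ x : M, TangentSpace (𝓡 (n + 1)) x}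
    (hW : SmoothFieldAt W x) {f : M → ℝ} (hf : MDifferentiableAt (𝓡 (n + 1)) 𝓘(ℝ) f x)
    (hSW : ∀ᶠ y in 𝓝 x, S y (W y) = f y • W y) (v : TangentSpace (𝓡 (n + 1)) x) :
    H.nablaEnd cov S x v (W x) = mvfderiv (𝓡 (n + 1)) f x v • W x -
      (S x (H.nabla cov W x v) - f x • H.nabla cov W x v) := by
  rw [H.nablaEnd_apply cov hS hW.diff, H.nabla_congr_of_eventuallyEq cov hSW,
    H.nabla_smul cov hf hW.diff]
  abel

/-- The polarization of `v^♭ (∇S(v, v)) = 0` at a screen vector. -/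
lemma IsATensor.polarization (hcov : IsLeviCivita G cov) (hH : H.IsTotallyGeodesic cov)
    (hS : H.IsATensor cov S) {w : TangentSpace (𝓡 (n + 1)) x} (hw : w ∈ H.screen x)
    (u : TangentSpace (𝓡 (n + 1)) x) :
    2 * H.g x (H.nablaEnd cov S x w w) u + H.η x u * H.η x (H.nablaEnd cov S x w w) +
      H.g x (H.nablaEnd cov S x u w) w = 0 := by
  -- For the cubic form `F`, the part of `F(w + tu)` linear in `t` is `(F(w+u) - F(w-u))/2 - F(u)`.
  have h1 := hS.flat_nablaEnd x (w + u)
  have h2 := hS.flat_nablaEnd x (w + (-1 : ℝ) • u)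
  have h3 := hS.flat_nablaEnd x u
  have h5 := g_nablaEnd_symm hcov hH hS.contMDiff hS.symm w u w
  have hηw := H.η_screen x hw
  simp only [H.nablaEnd_add_right cov hS.contMDiff, nablaEnd_add_left,
    H.nablaEnd_smul_right cov hS.contMDiff, nablaEnd_smul_left, flat_apply, map_add, map_smul,
    LinearMap.add_apply, LinearMap.smul_apply, hηw, smul_eq_mul] at h1 h2 h3
  have h6 := H.g_comm w (H.nablaEnd cov S x w u)
  have h7 := H.g_comm w (H.nablaEnd cov S x u w)
  have h8 := H.g_comm u (H.nablaEnd cov S x w w)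
  linear_combination (1 / 2) * h1 - (1 / 2) * h2 - h3 - h5 - h6 - h7 - 2 * h8

lemma IsATensor.η_apply (hS : H.IsATensor cov S) {c : ℝ} (hξ : S x (H.ξ x) = c • H.ξ x)
    (v : TangentSpace (𝓡 (n + 1)) x) : H.η x (S x v) = c * H.η x v := by
  conv_lhs => rw [H.eq_P_add x v]
  rw [map_add, map_add, ← hS.screen_preserving, H.η_screen x (H.P_mem_screen x _), map_smul, hξ,
    map_smul, map_smul, η_ξ]
  simp [mul_comm]

/-! ### Local sections of the eigendistributions and the four assertions. -/

section Eigen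

variable {k : ℕ} {ev : Fin (k + 1) → M → ℝ}

lemma mem_eigenDistribution_succ {i : Fin k} {v : TangentSpace (𝓡 (n + 1)) x} :
    v ∈ H.eigenDistribution S ev i.succ x ↔ v ∈ H.screen x ∧ S x v = ev i.succ x • v := by
  change v ∈ H.screen x ⊓ _ ↔ _
  rw [Submodule.mem_inf, LinearMap.mem_ker]
  simp [sub_eq_zero]

lemma IsEigenfunctions.mdifferentiableAt (hev : H.IsEigenfunctions S ev) (a : Fin (k + 1)) :
    MDifferentiableAt (𝓡 (n + 1)) 𝓘(ℝ) (ev a) x :=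
  (hev.contMDiff a x).mdifferentiableAt (by simp)

lemma smoothFieldAt_aeval (hS : SmoothEnd S) (hev : H.IsEigenfunctions S ev) (s : Finset (Fin k))
    {W : ∀ x : M, TangentSpace (𝓡 (n + 1)) x} (hW : SmoothFieldAt W x) :
    SmoothFieldAt (fun y ↦ Polynomial.aeval (R := ℝ) (A := Module.End ℝ (TangentSpace (𝓡 (n + 1)) y))
      (S y).toLinearMap (∏ j ∈ s, (Polynomial.X - Polynomial.C (ev j.succ y))) (W y)) x := by
  classical
  induction s using Finset.induction_on with
  | empty => simpa using hW
  | insert a s ha ih =>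
    simp only [aeval_prod_insert_apply ha]
    exact ContMDiffAt.sub_section (SmoothFieldAt.end_apply hS ih)
      (ContMDiffAt.smul_section (hev.contMDiff a.succ x) ih)

lemma IsATensor.apply_mem_screen (hS : H.IsATensor cov S) {v : TangentSpace (𝓡 (n + 1)) x}
    (hv : v ∈ H.screen x) : S x v ∈ H.screen x := by
  rw [← H.P_of_mem_screen hv, ← hS.screen_preserving]
  exact H.P_mem_screen x _

lemma IsATensor.aeval_mem_screen (hS : H.IsATensor cov S) (s : Finset (Fin k))
    {v : TangentSpace (𝓡 (n + 1)) x} (hv : v ∈ H.screen x) :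
    Polynomial.aeval (R := ℝ) (A := Module.End ℝ (TangentSpace (𝓡 (n + 1)) x))
      (S x).toLinearMap (∏ j ∈ s, (Polynomial.X - Polynomial.C (ev j.succ x))) v ∈ H.screen x := by
  classical
  induction s using Finset.induction_on with
  | empty => simpa using hv
  | insert a s ha ih =>
    rw [aeval_prod_insert_apply ha]
    exact sub_mem (hS.apply_mem_screen ih) (Submodule.smul_mem _ _ ih)

/-- On the screen `S` is diagonalizable and its only eigenvalues are the `λ_j`. -/
lemma IsATensor.aeval_univ_eq_zero (hS : H.IsATensor cov S) (hev : H.IsEigenfunctions S ev)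
    {v : TangentSpace (𝓡 (n + 1)) x} (hv : v ∈ H.screen x) :
    Polynomial.aeval (R := ℝ) (A := Module.End ℝ (TangentSpace (𝓡 (n + 1)) x))
      (S x).toLinearMap (∏ j : Fin k, (Polynomial.X - Polynomial.C (ev j.succ x))) v = 0 := by
  have := finite_tangent (n + 1) x
  refine aeval_apply_eq_zero_of_symm (H.g x) H.g_comm (S x).toLinearMap (hS.symm x) (H.screen x)
    (fun v hv ↦ hS.apply_mem_screen hv) (fun v hv h0 ↦ H.g_pos_of_mem_screen hv h0) _ ?_ hv
  intro μ w hw h0 hSw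
  have h1 : μ ∈ range (fun i : Fin k ↦ ev i.succ x) := by
    rw [hev.range_eq]
    exact ⟨w, hw, h0, hSw⟩
  obtain ⟨i, rfl⟩ := h1
  rw [Polynomial.eval_prod]
  exact Finset.prod_eq_zero (Finset.mem_univ i) (by simp)

/-- Every vector of `D_i` extends to a local smooth section of `D_i`. -/
lemma IsATensor.exists_extension (hS : H.IsATensor cov S) (hev : H.IsEigenfunctions S ev)
    {i : Fin k} {v : TangentSpace (𝓡 (n + 1)) x} (hv : v ∈ H.eigenDistribution S ev i.succ x) :
    ∃ W : ∀ y : M, TangentSpace (𝓡 (n + 1)) y, SmoothFieldAt W x ∧ W x = v ∧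
      ∀ y, W y ∈ H.eigenDistribution S ev i.succ y := by
  classical
  rw [mem_eigenDistribution_succ] at hv
  set E := FiberBundle.extend (EuclideanSpace ℝ (Fin (n + 1))) v with hE
  -- The product of the `S - λ_j`, `j ≠ i`, multiplies `v` by this number, nonzero since the
  -- eigenvalues are distinct; dividing by it makes the section pass through `v`.
  set c := ∏ j ∈ Finset.univ.erase i, (ev i.succ x - ev j.succ x) with hc
  have hc0 : c ≠ 0 := Finset.prod_ne_zero_iff.2 fun j hj ↦
    sub_ne_zero.2 fun h ↦ (Finset.ne_of_mem_erase hj) (hev.injective x h).symm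
  refine ⟨fun y ↦ c⁻¹ • Polynomial.aeval (R := ℝ)
    (A := Module.End ℝ (TangentSpace (𝓡 (n + 1)) y)) (S y).toLinearMap
    (∏ j ∈ Finset.univ.erase i, (Polynomial.X - Polynomial.C (ev j.succ y))) (H.P y (E y)),
    ?_, ?_, fun y ↦ ?_⟩
  · exact ContMDiffAt.const_smul_section
      (smoothFieldAt_aeval hS.contMDiff hev _ (H.smoothFieldAt_P (smoothFieldAt_extend v)))
  · have h1 : H.P x (E x) = v := by
      rw [hE, FiberBundle.extend_apply_self, H.P_of_mem_screen hv.1]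
    simp only [h1]
    rw [aeval_prod_X_sub_C_apply _ _ _ hv.2, ← hc, inv_smul_smul₀ hc0]
  · refine Submodule.smul_mem _ _ ?_
    rw [mem_eigenDistribution_succ]
    refine ⟨hS.aeval_mem_screen _ (H.P_mem_screen y _), ?_⟩
    -- The missing factor `S - λ_i` completes the annihilating product, so the field consists of
    -- eigenvectors.
    have h2 := hS.aeval_univ_eq_zero hev (H.P_mem_screen y (E y))
    rw [← Finset.insert_erase (Finset.mem_univ i),
      aeval_prod_insert_apply (Finset.notMem_erase i _)] at h2
    exact sub_eq_zero.1 h2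

/-- By symmetry of `S`, the image of `S - λ_i` is `g`-orthogonal to `X`, so only the derivative of
`λ_i` survives. -/
lemma g_nablaEnd_eigen (hS : H.IsATensor cov S) (hev : H.IsEigenfunctions S ev)
    {i : Fin k} {X : TangentSpace (𝓡 (n + 1)) x}
    (hX : X ∈ H.eigenDistribution S ev i.succ x) (v : TangentSpace (𝓡 (n + 1)) x) :
    H.g x (H.nablaEnd cov S x v X) X = mvfderiv (𝓡 (n + 1)) (ev i.succ) x v * H.g x X X := by
  obtain ⟨W, hW, rfl, hWD⟩ := hS.exists_extension hev hX
  have h := mem_eigenDistribution_succ.1 hX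
  rw [nablaEnd_eigen hS.contMDiff hW (hev.mdifferentiableAt _)
    (Filter.Eventually.of_forall fun y ↦ (mem_eigenDistribution_succ.1 (hWD y)).2)]
  simp only [map_sub, LinearMap.sub_apply, map_smul, LinearMap.smul_apply, hS.symm, h.2,
    smul_eq_mul]
  ring

lemma polarization_eigen (hcov : IsLeviCivita G cov) (hH : H.IsTotallyGeodesic cov)
    (hS : H.IsATensor cov S) (hev : H.IsEigenfunctions S ev)
    {i : Fin k} {X : TangentSpace (𝓡 (n + 1)) x}
    (hX : X ∈ H.eigenDistribution S ev i.succ x) (Y : TangentSpace (𝓡 (n + 1)) x) :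
    2 * H.g x (H.nablaEnd cov S x X X) Y + H.η x Y * H.η x (H.nablaEnd cov S x X X) +
      mvfderiv (𝓡 (n + 1)) (ev i.succ) x Y * H.g x X X = 0 := by
  rw [← g_nablaEnd_eigen hS hev hX]
  exact hS.polarization hcov hH (mem_eigenDistribution_succ.1 hX).1 Y

lemma mvfderiv_eigen_succ (hcov : IsLeviCivita G cov) (hH : H.IsTotallyGeodesic cov)
    (hS : H.IsATensor cov S) (hev : H.IsEigenfunctions S ev)
    {i : Fin k} {X : TangentSpace (𝓡 (n + 1)) x}
    (hX : X ∈ H.eigenDistribution S ev i.succ x) : mvfderiv (𝓡 (n + 1)) (ev i.succ) x X = 0 := by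
  have h := mem_eigenDistribution_succ.1 hX
  rcases eq_or_ne X 0 with rfl | h0
  · exact map_zero _
  · have h1 := polarization_eigen hcov hH hS hev hX X
    rw [g_nablaEnd_eigen hS hev hX, H.η_screen x h.1] at h1
    have h2 := (H.g_pos_of_mem_screen h.1 h0).ne'
    -- At `Y = X` the polarized identity is three times this product.
    have h3 : mvfderiv (𝓡 (n + 1)) (ev i.succ) x X * H.g x X X = 0 := by linarith
    exact (mul_eq_zero.1 h3).resolve_right h2

/-- On `ξ` the tensor condition reduces to `η(∇S(ξ, ξ)) = 0`. As `η ∘ S = λ₀ η`, the connection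
terms cancel and `ξ·λ₀` remains. -/
lemma mvfderiv_eigen_zero (hS : H.IsATensor cov S) (hev : H.IsEigenfunctions S ev)
    {X : TangentSpace (𝓡 (n + 1)) x} (hX : X ∈ H.rad x) :
    mvfderiv (𝓡 (n + 1)) (ev 0) x X = 0 := by
  rw [rad_eq_span, Submodule.mem_span_singleton] at hX
  obtain ⟨c, rfl⟩ := hX
  have h1 := hS.flat_nablaEnd x (H.ξ x)
  have h2 := nablaEnd_eigen (H := H) (cov := cov) hS.contMDiff (H.contMDiff_ξ x)
    (hev.mdifferentiableAt 0) (Filter.Eventually.of_forall hev.apply_ξ) (H.ξ x)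
  rw [h2, flat_apply, g_ξ_left, η_ξ, map_sub, map_sub, hS.η_apply (hev.apply_ξ x), map_smul,
    map_smul, η_ξ] at h1
  rw [map_smul]
  simp only [smul_eq_mul] at h1 ⊢
  linear_combination c * h1

lemma nablaEnd_eigen_self (hcov : IsLeviCivita G cov) (hH : H.IsTotallyGeodesic cov)
    (hS : H.IsATensor cov S) (hev : H.IsEigenfunctions S ev)
    {i : Fin k} {X : TangentSpace (𝓡 (n + 1)) x}
    (hX : X ∈ H.eigenDistribution S ev i.succ x) :
    H.nablaEnd cov S x X X =
      (-(1 / 2 : ℝ) * H.g x X X) • H.grad (ev i.succ) x +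
        ((1 / 2 : ℝ) * H.g x X X * H.η x (H.grad (ev i.succ) x) +
          (ev i.succ x - ev 0 x) * H.C cov x X X) • H.ξ x := by
  -- Along a section of `D_i`, `∇S(X,X) = -(S - λ_i)∇_X X` because `X·λ_i = 0`; then `η ∘ S = λ₀ η`
  -- produces the factor `λ_i - λ₀`.
  have hη : H.η x (H.nablaEnd cov S x X X) = (ev i.succ x - ev 0 x) * H.C cov x X X := by
    obtain ⟨W, hW, hWx, hWD⟩ := hS.exists_extension hev hX
    have h1 := nablaEnd_eigen (H := H) (cov := cov) hS.contMDiff hW (hev.mdifferentiableAt i.succ)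
      (Filter.Eventually.of_forall fun y ↦ (mem_eigenDistribution_succ.1 (hWD y)).2) X
    have h2 := H.C_apply cov hW.diff
      (Filter.Eventually.of_forall fun y ↦ (mem_eigenDistribution_succ.1 (hWD y)).1) X
    rw [hWx] at h1 h2
    rw [h1, h2, mvfderiv_eigen_succ hcov hH hS hev hX, zero_smul, zero_sub, map_neg, map_sub,
      hS.η_apply (hev.apply_ξ x), map_smul, smul_eq_mul]
    ring
  -- At `ξ` the identity gives `η(∇S(X,X)) = -(ξ·λ_i)⟨X,X⟩`, and `ξ·λ_i = η(∇^g λ_i)`. These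
  -- reconcile the `ξ`-components after `♭` is applied to both sides.
  have hξ := polarization_eigen hcov hH hS hev hX (H.ξ x)
  have hgrad := H.flat_grad (ev i.succ) x (H.ξ x)
  rw [g_ξ, η_ξ] at hξ
  rw [flat_apply, g_ξ, η_ξ] at hgrad
  refine H.flat_injective x (LinearMap.ext fun v ↦ ?_)
  have h3 := polarization_eigen hcov hH hS hev hX v
  rw [map_add, map_smul, map_smul, LinearMap.add_apply, LinearMap.smul_apply,
    LinearMap.smul_apply, flat_grad, flat_apply, flat_apply, g_ξ_left, η_ξ, ← hη]
  simp only [smul_eq_mul]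
  linear_combination (1 / 2) * h3 - (1 / 2) * H.g x X X * H.η x v * hgrad - (1 / 2) * H.η x v * hξ

lemma g_eigen_eigen_eq_zero (hS : H.IsATensor cov S) (hev : H.IsEigenfunctions S ev)
    {i j : Fin k} (hij : i ≠ j) {X Y : TangentSpace (𝓡 (n + 1)) x}
    (hX : X ∈ H.eigenDistribution S ev i.succ x) (hY : Y ∈ H.eigenDistribution S ev j.succ x) :
    H.g x X Y = 0 := by
  have h := hS.symm x X Y
  rw [(mem_eigenDistribution_succ.1 hX).2, (mem_eigenDistribution_succ.1 hY).2, map_smul, map_smul,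
    LinearMap.smul_apply, smul_eq_mul, smul_eq_mul] at h
  have h1 : (ev i.succ x - ev j.succ x) * H.g x X Y = 0 := by linarith
  exact (mul_eq_zero.1 h1).resolve_left (sub_ne_zero.2 fun h ↦ hij (hev.injective x h))

/-- Paired with `Y ∈ D_j`, the operator `S - λ_i` acts as the scalar `λ_j - λ_i`, while `η(Y)` and
`⟨X, Y⟩` vanish, so the polarized identity can be solved for `⟨∇_X X, Y⟩`. -/
lemma g_nabla_eigen (hcov : IsLeviCivita G cov) (hH : H.IsTotallyGeodesic cov)
    (hS : H.IsATensor cov S) (hev : H.IsEigenfunctions S ev) {i j : Fin k} (hij : i ≠ j)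
    {X : ∀ x : M, TangentSpace (𝓡 (n + 1)) x} (hX : SmoothFieldAt X x)
    (hXD : ∀ᶠ y in 𝓝 x, X y ∈ H.eigenDistribution S ev i.succ y)
    {Y : TangentSpace (𝓡 (n + 1)) x} (hY : Y ∈ H.eigenDistribution S ev j.succ x) :
    H.g x (H.nabla cov X x (X x)) Y =
      (1 / 2 : ℝ) * (mvfderiv (𝓡 (n + 1)) (ev i.succ) x Y / (ev j.succ x - ev i.succ x)) *
        H.g x (X x) (X x) := by
  have hne : ev j.succ x - ev i.succ x ≠ 0 :=
    sub_ne_zero.2 fun h ↦ hij (hev.injective x h).symm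
  have hXx := hXD.self_of_nhds
  have h1 := polarization_eigen hcov hH hS hev hXx Y
  have h2 := mem_eigenDistribution_succ.1 hY
  rw [H.η_screen x h2.1, nablaEnd_eigen hS.contMDiff hX (hev.mdifferentiableAt i.succ)
    (hXD.mono fun y hy ↦ (mem_eigenDistribution_succ.1 hy).2)] at h1
  simp only [map_sub, LinearMap.sub_apply, map_smul, LinearMap.smul_apply, hS.symm, h2.2,
    smul_eq_mul, g_eigen_eigen_eq_zero hS hev hij hXx hY] at h1
  field_simp
  linarith

/-- `Rad TM` is a parallel distribution. -/
lemma g_nabla_rad (hcov : IsLeviCivita G cov) (hH : H.IsTotallyGeodesic cov)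
    {X : ∀ x : M, TangentSpace (𝓡 (n + 1)) x} (hX : SmoothFieldAt X x)
    (hXD : ∀ᶠ y in 𝓝 x, X y ∈ H.rad y) (v w : TangentSpace (𝓡 (n + 1)) x) :
    H.g x (H.nabla cov X x v) w = 0 := by
  have h := mvfderiv_g hcov hH hX (smoothFieldAt_extend w) v
  -- A radical field has zero product with every field; in the derivative of that product the term
  -- containing `X` itself vanishes too.
  have h0 : (fun y ↦ H.g y (X y) (FiberBundle.extend (EuclideanSpace ℝ (Fin (n + 1))) w y))
      =ᶠ[𝓝 x] fun _ ↦ (0 : ℝ) := hXD.mono fun y hy ↦ H.mem_rad_iff.1 hy _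
  rw [mvfderiv_congr_of_eventuallyEq h0, mvfderiv_const, H.mem_rad_iff.1 hXD.self_of_nhds,
    FiberBundle.extend_apply_self] at h
  simpa using h.symm

end Eigen

end Endomorphism

end LightlikeHypersurface

end Lightlike

open Lightlike LightlikeHypersurface in
theorem fact5p2 {n : ℕ}
    {L : Type*} [TopologicalSpace L] [T2Space L] [SigmaCompactSpace L]
    [ChartedSpace (EuclideanSpace ℝ (Fin (n + 2))) L] [IsManifold (𝓡 (n + 2)) ∞ L]
    {M : Type*} [TopologicalSpace M] [T2Space M] [SigmaCompactSpace M]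
    [ChartedSpace (EuclideanSpace ℝ (Fin (n + 1))) M] [IsManifold (𝓡 (n + 1)) ∞ M]
    (G : LorentzMetric (n + 2) L)
    (cov : CovariantDerivative (𝓡 (n + 2)) (EuclideanSpace ℝ (Fin (n + 2)))
      (TangentSpace (𝓡 (n + 2)) : L → Type _))
    (hcov : IsLeviCivita G cov)
    (H : LightlikeHypersurface M G) (hH : H.IsTotallyGeodesic cov)
    (S : ∀ x : M, TangentSpace (𝓡 (n + 1)) x →L[ℝ] TangentSpace (𝓡 (n + 1)) x)
    (hS : H.IsATensor cov S)
    {k : ℕ} (ev : Fin (k + 1) → M → ℝ) (hev : H.IsEigenfunctions S ev) :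
    (∀ (i : Fin k) (x : M), ∀ X ∈ H.eigenDistribution S ev i.succ x,
      H.nablaEnd cov S x X X =
        (-(1 / 2 : ℝ) * H.g x X X) • H.grad (ev i.succ) x +
          ((1 / 2 : ℝ) * H.g x X X * H.η x (H.grad (ev i.succ) x) +
            (ev i.succ x - ev 0 x) * H.C cov x X X) • H.ξ x) ∧
    (∀ (a : Fin (k + 1)) (x : M), ∀ X ∈ H.eigenDistribution S ev a x,
      mvfderiv (𝓡 (n + 1)) (ev a) x X = 0) ∧
    (∀ i j : Fin k, i ≠ j → ∀ (U : Set M), IsOpen U →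
      ∀ X Y : ∀ x : M, TangentSpace (𝓡 (n + 1)) x,
        ContMDiffOn (𝓡 (n + 1)) (𝓡 (n + 1)).tangent ∞
          (fun x ↦ (⟨x, X x⟩ : TangentBundle (𝓡 (n + 1)) M)) U →
        ContMDiffOn (𝓡 (n + 1)) (𝓡 (n + 1)).tangent ∞
          (fun x ↦ (⟨x, Y x⟩ : TangentBundle (𝓡 (n + 1)) M)) U →
        (∀ x ∈ U, X x ∈ H.eigenDistribution S ev i.succ x) →
        (∀ x ∈ U, Y x ∈ H.eigenDistribution S ev j.succ x) →
        ∀ x ∈ U, H.g x (H.nabla cov X x (X x)) (Y x) =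
          (1 / 2 : ℝ) * (mvfderiv (𝓡 (n + 1)) (ev i.succ) x (Y x) / (ev j.succ x - ev i.succ x)) *
            H.g x (X x) (X x)) ∧
    (∀ (U : Set M), IsOpen U →
      ∀ X Y : ∀ x : M, TangentSpace (𝓡 (n + 1)) x,
        ContMDiffOn (𝓡 (n + 1)) (𝓡 (n + 1)).tangent ∞
          (fun x ↦ (⟨x, X x⟩ : TangentBundle (𝓡 (n + 1)) M)) U →
        ContMDiffOn (𝓡 (n + 1)) (𝓡 (n + 1)).tangent ∞
          (fun x ↦ (⟨x, Y x⟩ : TangentBundle (𝓡 (n + 1)) M)) U →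
        ((∀ x ∈ U, X x ∈ H.eigenDistribution S ev 0 x) ∨
          (∀ x ∈ U, Y x ∈ H.eigenDistribution S ev 0 x)) →
        ∀ x ∈ U, H.g x (H.nabla cov X x (X x)) (Y x) = 0) := by
  refine ⟨fun i x X hX ↦ nablaEnd_eigen_self hcov hH hS hev hX, fun a x X hX ↦ ?_, ?_, ?_⟩
  · cases a using Fin.cases with
    | zero => exact mvfderiv_eigen_zero hS hev hX
    | succ i => exact mvfderiv_eigen_succ hcov hH hS hev hX
  · intro i j hij U hU X Y hX _ hXD hYD x hx
    exact g_nabla_eigen hcov hH hS hev hij (hX.contMDiffAt (hU.mem_nhds hx))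
      (Filter.eventually_of_mem (hU.mem_nhds hx) hXD) (hYD x hx)
  · rintro U hU X Y hX _ (hXD | hYD) x hx
    · exact g_nabla_rad hcov hH (hX.contMDiffAt (hU.mem_nhds hx))
        (Filter.eventually_of_mem (hU.mem_nhds hx) hXD) _ _
    · rw [g_comm]
      exact H.mem_rad_iff.1 (hYD x hx) _
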